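/- Let $b>1$ be an integer, let $A\subset\{0,1,\dots,b-1\}$ contain at least one nonzero digit, and let $N=\#A$, $s_0=\log_b N$, $\gamma_j=\sum_{a\in A}a^j$ (with $0^0=1$). Call a positive integer admissible if all its base-$b$ digits lie in $A$. The series $\sum_{n\text{ admissible}} n^{-s}$ converges for $\operatorname{Re} s>s_0$, and its sum has a meromorphic continuation $K$ to $\mathbb{C}$. For $m\in\mathbb{N}=\{0,1,2,\dots\}$ and $k\in\mathbb{Z}$ put $s_{m,k}=s_0-m+k\frac{2\pi i}{\log b}$ and let $\lambda_{m,k}$ be the residue (possibly zero) of $K$ at $s_{m,k}$. With $(x)_n=x(x+1)\cdots(x+n-1)$, define the modified residues $\mu_{m,k}$ by $$\lambda_{m,k}=\frac{-(-s_{0,k})_{m+1}}{m!}\,\mu_{m,k},$$ except when $k=0$ and $N\in\{1,b\}$. In these cases the factor can vanish, and one sets instead: if $N=1$ and $A=\{f\}$, then $\mu_{m,0}=\bigl(-\tfrac{f}{b-1}\bigr)^m$; if $N=b$, then $(\mu_{m,0})_{m\ge0}$ is the solution with $\mu_{0,0}=1$ of the recurrence (1) below for $k=0$, $m\ge1$.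 Then for all $m\in\mathbb{N}$ and $k\in\mathbb{Z}$: (1) $\displaystyle (1-b^{-m})\,\mu_{m,k}=-N^{-1}\sum_{j=1}^m\binom{m}{j}b^{-j}\gamma_j\,\mu_{m-j,k}$; (2) $\mu_{0,0}\neq0$ and $\displaystyle \mu_{m,k}=\frac{\mu_{0,k}}{\mu_{0,0}}\,\mu_{m,0}$; (3) $K$ has a pole at $s_{m,k}$ if and only if it has a pole at $s_{m,0}$ and a pole at $s_{0,k}$. -/

import Mathlib

open Filter Topology

namespace RestrictedDirichlet

/-- A positive integer is admissible when all its digits in base `b` belong to `A`. -/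
def Admissible (b : ℕ) (A : Finset ℕ) (n : ℕ) : Prop :=
  0 < n ∧ ∀ d ∈ Nat.digits b n, d ∈ A

/-- The abscissa `s₀ = log_b N`, with `N` the number of admissible digits. -/
noncomputable def abscissa (b : ℕ) (A : Finset ℕ) : ℝ :=
  Real.logb (b : ℝ) (A.card : ℝ)

/-- The terms of the restricted Dirichlet series: `n ^ (-s)` for admissible `n`, and `0` for
the other natural numbers. -/
noncomputable def term (b : ℕ) (A : Finset ℕ) (s : ℂ) : ℕ → ℂ :=
  Set.indicator {n : ℕ | Admissible b A n} (fun n => (n : ℂ) ^ (-s))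

/-- `K` is a meromorphic function on `ℂ` which for `Re s > s₀` is the sum of the restricted
Dirichlet series. -/
def IsMeromorphicContinuation (b : ℕ) (A : Finset ℕ) (K : ℂ → ℂ) : Prop :=
  (∀ s : ℂ, MeromorphicAt K s) ∧
    ∀ s : ℂ, abscissa b A < s.re → HasSum (term b A s) (K s)

/-- The residue of `f` at `z₀`: the value for small radii of the normalized integral along a
circle with center `z₀`. -/
noncomputable def residue (f : ℂ → ℂ) (z₀ : ℂ) : ℂ :=
  limUnder (𝓝[>] (0 : ℝ))
    (fun r : ℝ => (2 * (Real.pi : ℂ) * Complex.I)⁻¹ * ∮ z in C(z₀, r), f z)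

/-- The function `f` has a pole at `z₀`. -/
def IsPole (f : ℂ → ℂ) (z₀ : ℂ) : Prop :=
  MeromorphicAt f z₀ ∧ meromorphicOrderAt f z₀ < 0

/-- The candidate pole `s_{m,k} = s₀ - m + k * 2πi / log b`. -/
noncomputable def candidatePole (b : ℕ) (A : Finset ℕ) (m : ℕ) (k : ℤ) : ℂ :=
  (abscissa b A : ℂ) - (m : ℂ) +
    (k : ℂ) * (2 * (Real.pi : ℂ) * Complex.I / (Real.log (b : ℝ) : ℂ))

/-- The power sum `γ_j` of the admissible digits (with `0 ^ 0 = 1`). -/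
noncomputable def powerSum (A : Finset ℕ) (j : ℕ) : ℂ :=
  ∑ a ∈ A, (a : ℂ) ^ j

/-- The sequence `c` with `c 0 = 1` and, for `m ≥ 1`,
`(1 - b ^ (-m)) c_m = - N⁻¹ ∑_{i < m} (m choose (m - i)) b ^ (-(m - i)) γ_{m - i} c_i`. -/
noncomputable def normalizedSolution (b : ℕ) (A : Finset ℕ) : ℕ → ℂ
  | 0 => 1
  | m + 1 =>
      (-((A.card : ℂ)⁻¹) *
        ∑ i : Fin (m + 1),
          ((m + 1).choose (m + 1 - (i : ℕ)) : ℂ) * ((b : ℂ) ^ (m + 1 - (i : ℕ)))⁻¹ *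
            powerSum A (m + 1 - (i : ℕ)) * normalizedSolution b A (i : ℕ)) /
        (1 - ((b : ℂ) ^ (m + 1))⁻¹)
  decreasing_by exact i.isLt

open Classical in
/-- The modified residues `μ_{m,k}`. In general they are determined from the residues
`λ_{m,k}` by `λ_{m,k} = - ((-s_{0,k})_{m+1} / m!) μ_{m,k}`, where `(x)_n = x (x+1) ⋯ (x+n-1)`.
When `k = 0` and `N = 1` or `N = b` this Pochhammer symbol can vanish, and `μ_{m,0}` is then
defined separately: if `N = 1`, with `f` the only admissible digit, `μ_{m,0}` is
`(-f / (b - 1)) ^ m`; if `N = b`, it is the solution of the recurrence starting at `1`. -/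
noncomputable def modifiedResidue (b : ℕ) (A : Finset ℕ) (K : ℂ → ℂ) (m : ℕ) (k : ℤ) : ℂ :=
  if k = 0 ∧ A.card = 1 then (-(∑ a ∈ A, (a : ℂ)) / ((b : ℂ) - 1)) ^ m
  else if k = 0 ∧ A.card = b then normalizedSolution b A m
  else
    residue K (candidatePole b A m k) /
      (-((ascPochhammer ℂ (m + 1)).eval (-(candidatePole b A 0 k))) / (m.factorial : ℂ))

end RestrictedDirichlet

/-!
Every admissible integer is a nonzero digit or of the form `b m + a` with `m` admissible and
`a ∈ A`. Expanding `(b m + a) ^ (-s)` by the binomial series turns this into the functional equation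
`(1 - N⁻¹ b ^ s) K(s) = h(s) - N⁻¹ ∑_{j=1}^n (-s choose j) b ^ (-j) γ_j K(s + j)`,
with `h` analytic for `Re s > s₀ - n - 1`, which continues `K` one strip at a time and shows that
its poles at the points `s_{m,k}` are at most simple. The residue at `s₀` is nonzero because
`(1 - N b ^ (-σ)) K(σ)` stays at least `b ^ (-σ)` as `σ` decreases to `s₀`.

Taking residues at `s_{m,k}` gives a recurrence for `λ_{m,k}` with coefficients `-s_{m,k} choose j`.
Dividing `λ_{m,k}` by the factor in the definition of `μ_{m,k}` replaces these by `m choose j`. The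
new recurrence does not depend on `k` and determines its solutions up to a scalar, which is (2).
For (3), only `k = 0` and `N ∈ {1, b}` are exceptional: if `N = 1` the residues `λ_{m,0}` themselves
satisfy (1), and if `N = b` then `K = ζ` has no pole at a nonreal point.
-/

namespace RestrictedDirichlet

/-- The subtype of admissible positive integers, over which all the series below are summed. -/
abbrev AdmissibleNat (b : ℕ) (A : Finset ℕ) : Type := {n : ℕ // Admissible b A n}

section Digits

variable {b : ℕ} {A : Finset ℕ}

theorem admissible_of_mem {a : ℕ} (ha0 : a ≠ 0) (hab : a < b) (ha : a ∈ A) :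
    Admissible b A a := by
  refine ⟨ha0.bot_lt, ?_⟩
  simpa [Nat.digits_of_lt b a ha0 hab] using ha

theorem admissible_mul_add_iff (hb : 1 < b) {m a : ℕ} (hm : 0 < m) (hab : a < b) :
    Admissible b A (b * m + a) ↔ Admissible b A m ∧ a ∈ A := by
  have hpos : 0 < b * m + a := by positivity
  rw [Admissible, Admissible, add_comm, Nat.digits_add b hb a m hab (.inr hm.ne')]
  simp only [List.forall_mem_cons, hm, add_comm a, hpos, true_and]
  exact and_comm

theorem Admissible.div_of_le (hb : 1 < b) {n : ℕ} (hn : Admissible b A n) (hbn : b ≤ n) :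
    Admissible b A (n / b) ∧ n % b ∈ A := by
  rw [← admissible_mul_add_iff hb (Nat.div_pos hbn (by lia)) (Nat.mod_lt n (by lia)),
    Nat.div_add_mod]
  exact hn

theorem Admissible.mem_of_lt {n : ℕ} (hn : Admissible b A n) (hnb : n < b) : n ∈ A :=
  hn.2 n (by simp [Nat.digits_of_lt b n hn.1.ne' hnb])

/-- Removing the last digit: an admissible integer is either a single nonzero digit, or is obtained
from a smaller admissible integer by appending a digit. -/
noncomputable def admissibleNatEquiv (hb : 1 < b) (hA : ∀ a ∈ A, a < b) :
    A.erase 0 ⊕ AdmissibleNat b A × A ≃ AdmissibleNat b A where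
  toFun := Sum.elim
    (fun a => ⟨a, admissible_of_mem (Finset.ne_of_mem_erase a.2)
      (hA a (Finset.mem_of_mem_erase a.2)) (Finset.mem_of_mem_erase a.2)⟩)
    (fun p => ⟨b * p.1 + p.2, (admissible_mul_add_iff hb p.1.2.1 (hA _ p.2.2)).2 ⟨p.1.2, p.2.2⟩⟩)
  invFun n := if h : n.1 < b then
      .inl ⟨n, Finset.mem_erase.2 ⟨n.2.1.ne', n.2.mem_of_lt h⟩⟩
    else .inr (⟨n / b, (n.2.div_of_le hb (not_lt.1 h)).1⟩,
      ⟨n % b, (n.2.div_of_le hb (not_lt.1 h)).2⟩)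
  left_inv := by
    rintro (⟨a, ha⟩ | ⟨⟨m, hm⟩, ⟨a, ha⟩⟩)
    · simp [hA a (Finset.mem_of_mem_erase ha)]
    · have hle : b ≤ b * m + a := (Nat.le_mul_of_pos_right b hm.1).trans (Nat.le_add_right _ _)
      simp [hle.not_gt, Nat.mul_add_div (zero_lt_one.trans hb), Nat.mod_eq_of_lt (hA a ha),
        Nat.div_eq_of_lt (hA a ha)]
  right_inv := by
    rintro ⟨n, hn⟩
    by_cases h : n < b <;> simp [h, Nat.div_add_mod]

theorem hasSum_append_digit (hb : 1 < b) (hA : ∀ a ∈ A, a < b) {E : Type*}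
    [NormedAddCommGroup E] [CompleteSpace E] {f : ℕ → E} {z : E}
    (h : HasSum (fun n : AdmissibleNat b A => f n) z) :
    HasSum (fun m : AdmissibleNat b A => ∑ a ∈ A, f (b * m + a)) (z - ∑ a ∈ A.erase 0, f a) := by
  have hsplit : HasSum (Sum.elim (fun a : A.erase 0 => f a)
      fun p : AdmissibleNat b A × A => f (b * p.1 + p.2)) z := by
    refine ((admissibleNatEquiv hb hA).hasSum_iff.2 h).congr_fun ?_
    rintro (a | p) <;> rfl
  have happend : Summable fun p : AdmissibleNat b A × A => f (b * p.1 + p.2) :=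
    hsplit.summable.comp_injective Sum.inr_injective
  obtain rfl := hsplit.unique (HasSum.sum (Finset.hasSum (A.erase 0) f) happend.hasSum)
  rw [add_sub_cancel_left]
  exact (happend.hasSum.prod_fiberwise fun m => hasSum_fintype _).congr_fun fun m =>
    (Finset.sum_coe_sort A fun a => f (b * m + a)).symm

end Digits

section Summability

variable {b : ℕ} {A : Finset ℕ}

theorem one_sub_mul_tsum_le (hb : 1 < b) (hA : ∀ a ∈ A, a < b) {f : ℕ → ℝ} {q : ℝ}
    (hf : Summable fun n : AdmissibleNat b A => f n)
    (hq : ∀ m : AdmissibleNat b A, ∑ a ∈ A, f (b * m + a) ≤ q * f m) :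
    (1 - q) * ∑' n : AdmissibleNat b A, f n ≤ ∑ a ∈ A.erase 0, f a := by
  linarith [hasSum_le hq (hasSum_append_digit hb hA hf.hasSum) (hf.hasSum.mul_left q)]

theorem le_one_sub_mul_tsum (hb : 1 < b) (hA : ∀ a ∈ A, a < b) {f : ℕ → ℝ} {q : ℝ}
    (hf : Summable fun n : AdmissibleNat b A => f n)
    (hq : ∀ m : AdmissibleNat b A, q * f m ≤ ∑ a ∈ A, f (b * m + a)) :
    ∑ a ∈ A.erase 0, f a ≤ (1 - q) * ∑' n : AdmissibleNat b A, f n := by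
  linarith [hasSum_le hq (hf.hasSum.mul_left q) (hasSum_append_digit hb hA hf.hasSum)]

theorem summable_of_sum_append_le (hb : 1 < b) (hA : ∀ a ∈ A, a < b) {f : ℕ → ℝ} {q : ℝ}
    (hf0 : ∀ n, 0 ≤ f n) (hq1 : q < 1)
    (hq : ∀ m : AdmissibleNat b A, ∑ a ∈ A, f (b * m + a) ≤ q * f m) :
    Summable fun n : AdmissibleNat b A => f n := by
  -- Truncation to `n < X` preserves the hypothesis and makes the sum finite, so it is bounded
  -- independently of `X`.
  set g : ℕ → ℕ → ℝ := fun X => (Set.Iio X).indicator f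
  have hg0 (X n : ℕ) : 0 ≤ g X n := Set.indicator_nonneg (fun n _ => hf0 n) n
  have hgf (X n : ℕ) : g X n ≤ f n := Set.indicator_le_self' (fun n _ => hf0 n) n
  have hgsum (X : ℕ) : Summable fun n : AdmissibleNat b A => g X n :=
    (summable_of_hasFiniteSupport ((Set.finite_Iio X).subset Set.support_indicator_subset)
      ).comp_injective Subtype.val_injective
  have hgq (X : ℕ) (m : AdmissibleNat b A) : ∑ a ∈ A, g X (b * m + a) ≤ q * g X m := by
    by_cases hm : m.1 < X
    · rw [show g X m = f m from Set.indicator_of_mem (s := Set.Iio X) hm f]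
      exact (Finset.sum_le_sum fun a _ => hgf X _).trans (hq m)
    · rw [show g X m = 0 from Set.indicator_of_notMem (s := Set.Iio X) hm f, mul_zero]
      refine (Finset.sum_eq_zero fun a _ => Set.indicator_of_notMem ?_ f).le
      have : m.1 ≤ b * m.1 := Nat.le_mul_of_pos_left _ (by lia)
      simp only [Set.mem_Iio]
      lia
  refine summable_of_sum_le (fun n => hf0 n) (c := (∑ a ∈ A.erase 0, f a) / (1 - q)) fun u => ?_
  obtain ⟨X, hX⟩ := (u.image Subtype.val).exists_nat_subset_range
  have hu : ∀ n ∈ u, g X n = f n := fun n hn => Set.indicator_of_mem (s := Set.Iio X)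
    (Finset.mem_range.1 (hX (Finset.mem_image_of_mem _ hn))) f
  rw [le_div_iff₀' (sub_pos.2 hq1), ← Finset.sum_congr rfl hu]
  calc (1 - q) * ∑ n ∈ u, g X n
      ≤ (1 - q) * ∑' n : AdmissibleNat b A, g X n := mul_le_mul_of_nonneg_left
        ((hgsum X).sum_le_tsum u fun n _ => hg0 X n) (sub_nonneg.2 hq1.le)
    _ ≤ ∑ a ∈ A.erase 0, g X a := one_sub_mul_tsum_le hb hA (hgsum X) (hgq X)
    _ ≤ ∑ a ∈ A.erase 0, f a := Finset.sum_le_sum fun a _ => hgf X a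

theorem abscissa_nonneg (b : ℕ) (A : Finset ℕ) : 0 ≤ abscissa b A :=
  div_nonneg (Real.log_natCast_nonneg _) (Real.log_natCast_nonneg _)

theorem rpow_abscissa (hb : 1 < b) (hA : A.Nonempty) : (b : ℝ) ^ abscissa b A = A.card :=
  Real.rpow_logb (by positivity) (by exact_mod_cast hb.ne') (by exact_mod_cast hA.card_pos)

theorem card_mul_rpow_neg_lt_one (hb : 1 < b) (hA : A.Nonempty) {σ : ℝ}
    (hσ : abscissa b A < σ) : A.card * (b : ℝ) ^ (-σ) < 1 := by
  rw [← rpow_abscissa hb hA, ← Real.rpow_add (by positivity)]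
  exact Real.rpow_lt_one_of_one_lt_of_neg (by exact_mod_cast hb) (by linarith)

theorem summable_rpow (hb : 1 < b) (hA : ∀ a ∈ A, a < b) (hne : A.Nonempty) {σ : ℝ}
    (hσ : abscissa b A < σ) : Summable fun n : AdmissibleNat b A => (n : ℝ) ^ (-σ) := by
  have hσ0 : 0 < σ := (abscissa_nonneg b A).trans_lt hσ
  refine summable_of_sum_append_le (f := fun n : ℕ => (n : ℝ) ^ (-σ)) hb hA
    (fun n => by positivity) (card_mul_rpow_neg_lt_one hb hne hσ) fun m => ?_
  have hm : (0 : ℝ) < m := by exact_mod_cast m.2.1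
  rw [mul_assoc, ← Real.mul_rpow (by positivity) hm.le, ← nsmul_eq_mul]
  refine Finset.sum_le_card_nsmul _ _ _ fun a _ => ?_
  exact Real.rpow_le_rpow_of_nonpos (by positivity) (by push_cast; simp) (by linarith)

theorem rpow_neg_le_mul_tsum (hb : 1 < b) (hA : ∀ a ∈ A, a < b) (hA1 : ∃ a ∈ A, a ≠ 0) {σ : ℝ}
    (hσ : abscissa b A < σ) :
    (b : ℝ) ^ (-σ) ≤
      (1 - A.card * (b : ℝ) ^ (-σ)) * ∑' n : AdmissibleNat b A, (n : ℝ) ^ (-σ) := by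
  obtain ⟨a₀, ha₀, ha₀0⟩ := hA1
  have hσ0 : 0 < σ := (abscissa_nonneg b A).trans_lt hσ
  have hsum := summable_rpow hb hA ⟨a₀, ha₀⟩ hσ
  -- Shifting the argument by one turns `b m + a < b (m + 1)` into a lower bound by `b ^ (-σ) f m`.
  set f : ℕ → ℝ := fun n => ((n : ℝ) + 1) ^ (-σ)
  have hf0 (n : ℕ) : 0 ≤ f n := by positivity
  have hf (n : AdmissibleNat b A) : f n ≤ (n : ℝ) ^ (-σ) :=
    Real.rpow_le_rpow_of_nonpos (by exact_mod_cast n.2.1) (by linarith) (by linarith)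
  have hfsum : Summable fun n : AdmissibleNat b A => f n := hsum.of_nonneg_of_le (fun n => hf0 n) hf
  have happend (m : AdmissibleNat b A) :
      A.card * (b : ℝ) ^ (-σ) * f m ≤ ∑ a ∈ A, f (b * m + a) := by
    rw [mul_assoc, ← Real.mul_rpow (by positivity) (by positivity), ← nsmul_eq_mul]
    refine Finset.card_nsmul_le_sum _ _ _ fun a ha => ?_
    refine Real.rpow_le_rpow_of_nonpos (by positivity) ?_ (by linarith)
    have : a + 1 ≤ b := hA a ha
    norm_cast
    lia
  calc (b : ℝ) ^ (-σ) ≤ f a₀ :=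
        Real.rpow_le_rpow_of_nonpos (by positivity) (by exact_mod_cast hA a₀ ha₀) (by linarith)
    _ ≤ ∑ a ∈ A.erase 0, f a :=
        Finset.single_le_sum (fun a _ => hf0 a) (Finset.mem_erase.2 ⟨ha₀0, ha₀⟩)
    _ ≤ (1 - A.card * (b : ℝ) ^ (-σ)) * ∑' n : AdmissibleNat b A, f n :=
        le_one_sub_mul_tsum hb hA hfsum happend
    _ ≤ _ := mul_le_mul_of_nonneg_left (hfsum.tsum_le_tsum hf hsum)
        (sub_nonneg.2 (card_mul_rpow_neg_lt_one hb ⟨a₀, ha₀⟩ hσ).le)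

end Summability

section BinomialRemainder

theorem choose_succ_mul (z : ℂ) (j : ℕ) :
    Ring.choose z (j + 1) * (j + 1) = z * Ring.choose (z - 1) j := by
  have h := Ring.choose_smul_choose z (Nat.le_add_left 1 j)
  simpa [Nat.choose_one_right, mul_comm] using h

theorem differentiable_choose (j : ℕ) : Differentiable ℂ fun z : ℂ => Ring.choose z j := by
  induction j with
  | zero => simp
  | succ j ih =>
    have hdiv : (fun z : ℂ => Ring.choose z (j + 1)) =
        fun z : ℂ => z * Ring.choose (z - 1) j / (j + 1) := by
      funext z
      rw [← choose_succ_mul, mul_div_cancel_right₀ _ (Nat.cast_add_one_ne_zero j)]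
    rw [hdiv]
    fun_prop

/-- The remainder of the binomial series of `(1 + x) ^ z` after the first `n` terms. -/
noncomputable def binomialRemainder (n : ℕ) (z x : ℂ) : ℂ :=
  (1 + x) ^ z - ∑ j ∈ Finset.range n, Ring.choose z j * x ^ j

theorem binomialRemainder_succ_zero (n : ℕ) (z : ℂ) : binomialRemainder (n + 1) z 0 = 0 := by
  simp [binomialRemainder, Finset.sum_range_succ']

theorem hasDerivAt_binomialRemainder (n : ℕ) (z : ℂ) {x : ℂ} (hx : 1 + x ∈ Complex.slitPlane) :
    HasDerivAt (binomialRemainder (n + 1) z) (z * binomialRemainder n (z - 1) x) x := by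
  have hpow : HasDerivAt (fun x : ℂ => (1 + x) ^ z) (z * (1 + x) ^ (z - 1) * 1) x :=
    ((hasDerivAt_id x).const_add 1).cpow_const hx
  have hsum : HasDerivAt (fun x : ℂ => ∑ j ∈ Finset.range (n + 1), Ring.choose z j * x ^ j)
      (∑ j ∈ Finset.range (n + 1), Ring.choose z j * (j * x ^ (j - 1))) x :=
    HasDerivAt.fun_sum fun j _ => (hasDerivAt_pow j x).const_mul _
  refine (hpow.sub hsum).congr_deriv ?_
  rw [Finset.sum_range_succ', binomialRemainder, mul_sub, Finset.mul_sum]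
  simp only [Nat.cast_zero, zero_mul, mul_zero, add_zero, mul_one, Nat.add_sub_cancel]
  congr 1
  refine Finset.sum_congr rfl fun j _ => ?_
  push_cast
  linear_combination x ^ j * choose_succ_mul z j

theorem norm_one_add_cpow_le {M : ℝ} {z : ℂ} (hz : ‖z‖ ≤ M) {x : ℝ} (hx0 : 0 ≤ x) (hx1 : x ≤ 1) :
    ‖(1 + x : ℂ) ^ z‖ ≤ 2 ^ M := by
  rw [← Complex.ofReal_one, ← Complex.ofReal_add,
    Complex.norm_cpow_eq_rpow_re_of_pos (by positivity)]
  calc (1 + x) ^ z.re ≤ (1 + x) ^ M :=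
        Real.rpow_le_rpow_of_exponent_le (by linarith) ((Complex.re_le_norm z).trans hz)
    _ ≤ 2 ^ M := Real.rpow_le_rpow (by linarith) (by linarith) ((norm_nonneg z).trans hz)

theorem exists_norm_binomialRemainder_le (n : ℕ) (M : ℝ) :
    ∃ C : ℝ, 0 ≤ C ∧ ∀ z : ℂ, ‖z‖ ≤ M → ∀ x : ℝ, 0 ≤ x → x ≤ 1 →
      ‖binomialRemainder n z x‖ ≤ C * x ^ n := by
  induction n generalizing M with
  | zero =>
    exact ⟨2 ^ M, by positivity, fun z hz x hx0 hx1 => by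
      simpa [binomialRemainder] using norm_one_add_cpow_le hz hx0 hx1⟩
  | succ n ih =>
    obtain ⟨C, hC, hbound⟩ := ih (M + 1)
    refine ⟨|M| * C, by positivity, fun z hz x hx0 hx1 => ?_⟩
    have hz1 : ‖z - 1‖ ≤ M + 1 := (norm_sub_le _ _).trans (by simpa using hz)
    have hderiv : ∀ y ∈ Set.Icc 0 x, HasDerivWithinAt (fun y : ℝ => binomialRemainder (n + 1) z y)
        (z * binomialRemainder n (z - 1) y) (Set.Icc 0 x) y := by
      refine fun y hy => (hasDerivAt_binomialRemainder n z ?_).comp_ofReal.hasDerivWithinAt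
      rw [← Complex.ofReal_one, ← Complex.ofReal_add, Complex.ofReal_mem_slitPlane]
      linarith [hy.1]
    have hderiv_le : ∀ y ∈ Set.Ico 0 x,
        ‖z * binomialRemainder n (z - 1) y‖ ≤ |M| * C * x ^ n := by
      intro y hy
      have hy1 : y ≤ 1 := hy.2.le.trans hx1
      calc ‖z * binomialRemainder n (z - 1) y‖ ≤ |M| * (C * y ^ n) := by
            rw [norm_mul]
            gcongr
            exacts [hz.trans (le_abs_self M), hbound (z - 1) hz1 y hy.1 hy1]
        _ ≤ |M| * C * x ^ n := by
            rw [mul_assoc]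
            gcongr
            exacts [hy.1, hy.2.le]
    have hmean := norm_image_sub_le_of_norm_deriv_le_segment' hderiv hderiv_le x
      (Set.right_mem_Icc.2 hx0)
    rwa [Complex.ofReal_zero, binomialRemainder_succ_zero, sub_zero, sub_zero, mul_assoc,
      ← pow_succ] at hmean

theorem differentiable_binomialRemainder (n : ℕ) {x : ℂ} (hx : 1 + x ≠ 0) :
    Differentiable ℂ fun z => binomialRemainder n z x := by
  refine Differentiable.sub (fun z => differentiableAt_id.const_cpow (.inl hx)) ?_
  exact Differentiable.fun_sum fun j _ => (differentiable_choose j).mul_const _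

end BinomialRemainder

section Series

variable {b : ℕ} {A : Finset ℕ}

/-- Terms of size `O(n ^ (-(Re s + r)))` as `n` runs through the admissible integers, uniformly for
bounded `s`. The sum of such terms converges for `s₀ < Re s + r`. -/
def HasDirichletDecay (r : ℝ) (F : AdmissibleNat b A → ℂ → ℂ) : Prop :=
  ∀ M : ℝ, ∃ C : ℝ, ∀ s : ℂ, ‖s‖ ≤ M → ∀ n, ‖F n s‖ ≤ C * (n : ℝ) ^ (-(s.re + r))

namespace HasDirichletDecay

variable {r : ℝ} {F : AdmissibleNat b A → ℂ → ℂ}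

theorem summable (hF : HasDirichletDecay r F) (hb : 1 < b) (hA : ∀ a ∈ A, a < b)
    (hne : A.Nonempty) {s : ℂ} (hs : abscissa b A < s.re + r) : Summable fun n => F n s := by
  obtain ⟨C, hC⟩ := hF ‖s‖
  exact ((summable_rpow hb hA hne hs).mul_left C).of_norm_bounded (hC s le_rfl)

theorem analyticAt_tsum (hF : HasDirichletDecay r F) (hb : 1 < b) (hA : ∀ a ∈ A, a < b)
    (hne : A.Nonempty) (hdiff : ∀ n, Differentiable ℂ (F n)) {s₁ : ℂ}
    (hs₁ : abscissa b A < s₁.re + r) : AnalyticAt ℂ (fun s => ∑' n, F n s) s₁ := by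
  obtain ⟨σ, hσ, hσ₁⟩ := exists_between hs₁
  obtain ⟨C, hC⟩ := hF (‖s₁‖ + 1)
  set U : Set ℂ := Metric.ball s₁ 1 ∩ {s | σ < s.re + r}
  have hU : IsOpen U := Metric.isOpen_ball.inter (isOpen_lt continuous_const (by fun_prop))
  have hbound (n : AdmissibleNat b A) (s : ℂ) (hs : s ∈ U) : ‖F n s‖ ≤ |C| * (n : ℝ) ^ (-σ) := by
    have hnorm : ‖s‖ ≤ ‖s₁‖ + 1 := by
      linarith [norm_le_norm_add_norm_sub' s s₁, mem_ball_iff_norm.1 hs.1]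
    have hσs : -(s.re + r) ≤ -σ := neg_le_neg hs.2.le
    refine (hC s hnorm n).trans ?_
    gcongr
    exacts [le_abs_self C, Nat.one_le_cast.2 n.2.1]
  exact (Complex.differentiableOn_tsum_of_summable_norm ((summable_rpow hb hA hne hσ).mul_left |C|)
    (fun n => (hdiff n).differentiableOn) hU hbound).analyticAt
      (hU.mem_nhds ⟨Metric.mem_ball_self one_pos, hσ₁⟩)

end HasDirichletDecay

theorem norm_natCast_cpow_neg {n : ℕ} (hn : 0 < n) (s : ℂ) :
    ‖(n : ℂ) ^ (-s)‖ = (n : ℝ) ^ (-s.re) :=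
  Complex.norm_natCast_cpow_of_pos hn (-s)

theorem differentiable_natCast_cpow_neg {n : ℕ} (hn : n ≠ 0) :
    Differentiable ℂ fun s : ℂ => (n : ℂ) ^ (-s) :=
  fun _ => differentiableAt_id.neg.const_cpow (.inl (Nat.cast_ne_zero.2 hn))

theorem hasDirichletDecay_cpow :
    HasDirichletDecay 0 fun (n : AdmissibleNat b A) s => (n : ℂ) ^ (-s) :=
  fun _ => ⟨1, fun s _ n => by rw [norm_natCast_cpow_neg n.2.1, add_zero, one_mul]⟩

/-- The sum of the restricted Dirichlet series. -/
noncomputable def dirichletSum (b : ℕ) (A : Finset ℕ) (s : ℂ) : ℂ :=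
  ∑' n : AdmissibleNat b A, (n : ℂ) ^ (-s)

/-- The contribution of the one-digit integers to the restricted Dirichlet series. -/
noncomputable def digitSum (A : Finset ℕ) (s : ℂ) : ℂ :=
  ∑ a ∈ A.erase 0, (a : ℂ) ^ (-s)

/-- The error made when `(b m + a) ^ (-s) = (b m) ^ (-s) (1 + a / (b m)) ^ (-s)` is expanded by the
first `n` terms of the binomial series, summed over the digits `a` and divided by `b ^ (-s)`. -/
noncomputable def remainderTerm (A : Finset ℕ) (b n m : ℕ) (s : ℂ) : ℂ :=
  (m : ℂ) ^ (-s) * ∑ a ∈ A, binomialRemainder n (-s) (a / (b * m) : ℝ)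

/-- The sum of the binomial remainders over the admissible integers. -/
noncomputable def remainderSum (b : ℕ) (A : Finset ℕ) (n : ℕ) (s : ℂ) : ℂ :=
  ∑' m : AdmissibleNat b A, remainderTerm A b n m s

theorem summable_cpow (hb : 1 < b) (hA : ∀ a ∈ A, a < b) (hne : A.Nonempty) {s : ℂ}
    (hs : abscissa b A < s.re) : Summable fun n : AdmissibleNat b A => (n : ℂ) ^ (-s) :=
  hasDirichletDecay_cpow.summable hb hA hne (by rwa [add_zero])

theorem analyticAt_dirichletSum (hb : 1 < b) (hA : ∀ a ∈ A, a < b) (hne : A.Nonempty) {s : ℂ}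
    (hs : abscissa b A < s.re) : AnalyticAt ℂ (dirichletSum b A) s :=
  hasDirichletDecay_cpow.analyticAt_tsum hb hA hne
    (fun n => differentiable_natCast_cpow_neg n.2.1.ne') (by rwa [add_zero])

theorem differentiable_digitSum (A : Finset ℕ) : Differentiable ℂ (digitSum A) :=
  Differentiable.fun_sum fun _ ha => differentiable_natCast_cpow_neg (Finset.ne_of_mem_erase ha)

theorem differentiable_remainderTerm (A : Finset ℕ) (b n : ℕ) {m : ℕ} (hm : m ≠ 0) :
    Differentiable ℂ (remainderTerm A b n m) := by
  refine (differentiable_natCast_cpow_neg hm).mul (Differentiable.fun_sum fun a _ => ?_)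
  refine (differentiable_binomialRemainder n ?_).comp differentiable_neg
  have : (1 + a / (b * m) : ℝ) ≠ 0 := by positivity
  exact_mod_cast this

theorem hasDirichletDecay_remainderTerm (hA : ∀ a ∈ A, a < b) (n : ℕ) :
    HasDirichletDecay n fun m : AdmissibleNat b A => remainderTerm A b n m := by
  intro M
  obtain ⟨C, hC0, hC⟩ := exists_norm_binomialRemainder_le n M
  refine ⟨A.card * C, fun s hs m => ?_⟩
  have hm1 : (1 : ℝ) ≤ m := by exact_mod_cast m.2.1
  have hm0 : (0 : ℝ) < m := one_pos.trans_le hm1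
  have hdigit : ∀ a ∈ A, ‖binomialRemainder n (-s) (a / (b * m) : ℝ)‖ ≤ C * (m : ℝ)⁻¹ ^ n := by
    intro a ha
    have hx : (a / (b * m) : ℝ) ≤ (m : ℝ)⁻¹ := by
      rw [div_mul_eq_div_div, div_eq_mul_inv]
      have hab : (a : ℝ) ≤ b := by exact_mod_cast (hA a ha).le
      exact mul_le_of_le_one_left (by positivity) (div_le_one_of_le₀ hab (by positivity))
    refine (hC (-s) (by rwa [norm_neg]) _ (by positivity)
      (hx.trans (inv_le_one_of_one_le₀ hm1))).trans ?_
    gcongr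
  calc ‖remainderTerm A b n m s‖ ≤ (m : ℝ) ^ (-s.re) * (A.card * (C * (m : ℝ)⁻¹ ^ n)) := by
        rw [remainderTerm, norm_mul, norm_natCast_cpow_neg m.2.1, ← nsmul_eq_mul A.card,
          ← Finset.sum_const]
        gcongr
        exact norm_sum_le_of_le _ hdigit
    _ = A.card * C * (m : ℝ) ^ (-(s.re + n)) := by
        rw [neg_add, Real.rpow_add hm0, Real.rpow_neg hm0.le n, Real.rpow_natCast, inv_pow]
        ring

theorem summable_remainderTerm (hb : 1 < b) (hA : ∀ a ∈ A, a < b) (hne : A.Nonempty) (n : ℕ)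
    {s : ℂ} (hs : abscissa b A < s.re + n) :
    Summable fun m : AdmissibleNat b A => remainderTerm A b n m s :=
  (hasDirichletDecay_remainderTerm hA n).summable hb hA hne hs

theorem analyticAt_remainderSum (hb : 1 < b) (hA : ∀ a ∈ A, a < b) (hne : A.Nonempty) (n : ℕ)
    {s : ℂ} (hs : abscissa b A < s.re + n) : AnalyticAt ℂ (remainderSum b A n) s :=
  (hasDirichletDecay_remainderTerm hA n).analyticAt_tsum hb hA hne
    (fun m => differentiable_remainderTerm A b n m.2.1.ne') hs

theorem cpow_mul_add (hb : 0 < b) (n : ℕ) (s : ℂ) {m : ℕ} (hm : 0 < m) (a : ℕ) :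
    ((b * m + a : ℕ) : ℂ) ^ (-s) = (b : ℂ) ^ (-s) *
      ((∑ j ∈ Finset.range n, Ring.choose (-s) j * ((b : ℂ) ^ j)⁻¹ * a ^ j * (m : ℂ) ^ (-(s + j))) +
        (m : ℂ) ^ (-s) * binomialRemainder n (-s) (a / (b * m) : ℝ)) := by
  have hmC : (m : ℂ) ≠ 0 := by exact_mod_cast hm.ne'
  have hfactor : ((b * m + a : ℕ) : ℂ) ^ (-s) =
      (b : ℂ) ^ (-s) * ((m : ℂ) ^ (-s) * (1 + (a / (b * m) : ℝ)) ^ (-s)) := by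
    have hreal : ((b * m + a : ℕ) : ℝ) = b * (m * (1 + a / (b * m))) := by
      push_cast
      field_simp
    rw [← Complex.ofReal_natCast, hreal, Complex.ofReal_mul,
      Complex.mul_cpow_ofReal_nonneg (by positivity) (by positivity), Complex.ofReal_mul,
      Complex.mul_cpow_ofReal_nonneg (by positivity) (by positivity)]
    push_cast
    rfl
  have hterm (j : ℕ) : Ring.choose (-s) j * ((b : ℂ) ^ j)⁻¹ * a ^ j * (m : ℂ) ^ (-(s + j)) =
      (m : ℂ) ^ (-s) * (Ring.choose (-s) j * ((a / (b * m) : ℝ) : ℂ) ^ j) := by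
    rw [neg_add, ← sub_eq_add_neg, Complex.cpow_sub _ _ hmC, Complex.cpow_natCast]
    push_cast
    rw [div_pow, mul_pow]
    field_simp
  rw [hfactor, Finset.sum_congr rfl fun j _ => hterm j, ← Finset.mul_sum, ← mul_add,
    binomialRemainder, add_sub_cancel]

theorem sum_cpow_mul_add (hb : 0 < b) (A : Finset ℕ) (n : ℕ) (s : ℂ) {m : ℕ} (hm : 0 < m) :
    ∑ a ∈ A, ((b * m + a : ℕ) : ℂ) ^ (-s) = (b : ℂ) ^ (-s) *
      ((∑ j ∈ Finset.range n, Ring.choose (-s) j * ((b : ℂ) ^ j)⁻¹ * powerSum A j *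
          (m : ℂ) ^ (-(s + j))) + remainderTerm A b n m s) := by
  rw [Finset.sum_congr rfl fun a _ => cpow_mul_add hb n s hm a, ← Finset.mul_sum,
    Finset.sum_add_distrib, Finset.sum_comm, remainderTerm, Finset.mul_sum]
  simp only [powerSum, Finset.mul_sum, Finset.sum_mul]

theorem dirichletSum_eq (hb : 1 < b) (hA : ∀ a ∈ A, a < b) (hne : A.Nonempty) (n : ℕ) {s : ℂ}
    (hs : abscissa b A < s.re) :
    dirichletSum b A s = digitSum A s + (b : ℂ) ^ (-s) *
      ((∑ j ∈ Finset.range n, Ring.choose (-s) j * ((b : ℂ) ^ j)⁻¹ * powerSum A j *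
          dirichletSum b A (s + j)) + remainderSum b A n s) := by
  have hdigits := hasSum_append_digit hb hA (f := fun n : ℕ => (n : ℂ) ^ (-s))
    (summable_cpow hb hA hne hs).hasSum
  have hshift (j : ℕ) : HasSum (fun m : AdmissibleNat b A => (m : ℂ) ^ (-(s + j)))
      (dirichletSum b A (s + j)) := by
    refine (summable_cpow hb hA hne ?_).hasSum
    rw [Complex.add_re, Complex.natCast_re]
    exact hs.trans_le (le_add_of_nonneg_right j.cast_nonneg)
  have hrem := (summable_remainderTerm hb hA hne n
    (hs.trans_le (le_add_of_nonneg_right n.cast_nonneg))).hasSum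
  have hexpand := (((hasSum_sum fun j (_ : j ∈ Finset.range n) => (hshift j).mul_left
    (Ring.choose (-s) j * ((b : ℂ) ^ j)⁻¹ * powerSum A j)).add hrem).mul_left ((b : ℂ) ^ (-s)))
  exact sub_eq_iff_eq_add'.1 (hdigits.unique (hexpand.congr_fun fun m =>
    sum_cpow_mul_add (zero_lt_one.trans hb) A n s m.2.1))

end Series

section Continuation

theorem eventuallyEq_of_meromorphicOn {U : Set ℂ} {f g : ℂ → ℂ} (hf : MeromorphicOn f U)
    (hg : MeromorphicOn g U) (hU : IsPreconnected U) {w z : ℂ} (hw : w ∈ U) (hz : z ∈ U)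
    (hfg : f =ᶠ[𝓝[≠] w] g) : f =ᶠ[𝓝[≠] z] g := by
  have hsub : meromorphicOrderAt (f - g) w = ⊤ :=
    meromorphicOrderAt_eq_top_iff.2 (hfg.mono fun u hu => sub_eq_zero.2 hu)
  have htop : meromorphicOrderAt (f - g) z = ⊤ := by
    by_contra hne
    exact (hf.sub hg).meromorphicOrderAt_ne_top_of_isPreconnected hU hz hw hne hsub
  exact (meromorphicOrderAt_eq_top_iff.1 htop).mono fun u hu => sub_eq_zero.1 hu

theorem eventuallyEq_of_eqOn_halfPlane {f g : ℂ → ℂ} {x y : ℝ}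
    (hf : ∀ z : ℂ, x < z.re → MeromorphicAt f z) (hg : ∀ z : ℂ, x < z.re → MeromorphicAt g z)
    (hfg : ∀ z : ℂ, y < z.re → f z = g z) {z : ℂ} (hz : x < z.re) : f =ᶠ[𝓝[≠] z] g := by
  obtain ⟨t, ht⟩ := exists_gt (max x y)
  have hfg_near : f =ᶠ[𝓝 (t : ℂ)] g := by
    filter_upwards [(isOpen_lt continuous_const Complex.continuous_re).mem_nhds
      (show y < (t : ℂ).re from (le_max_right x y).trans_lt ht)] using hfg
  exact eventuallyEq_of_meromorphicOn hf hg (convex_halfSpace_re_gt x).isPreconnected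
    (show x < (t : ℂ).re from (le_max_left x y).trans_lt ht) hz
    (hfg_near.filter_mono nhdsWithin_le_nhds)

theorem exists_meromorphic_of_halfPlanes {f : ℂ → ℂ} {x : ℝ}
    (h : ∀ n : ℕ, ∃ F : ℂ → ℂ, (∀ z : ℂ, x - n < z.re → MeromorphicAt F z) ∧
      ∀ z : ℂ, x < z.re → F z = f z) :
    ∃ K : ℂ → ℂ, (∀ z, MeromorphicAt K z) ∧ ∀ z : ℂ, x < z.re → K z = f z := by
  choose F hF hFf using h
  refine ⟨fun z => F (⌈x - z.re⌉₊ + 1) z, fun s => ?_, fun z hz => hFf _ z hz⟩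
  -- Near `s` only values of `F 0, …, F N` occur, and off `s` these agree where they continue `f`.
  set N := ⌈x - s.re⌉₊ + 2 with hN
  have hsN : x - N < s.re := by
    rw [hN]
    push_cast
    linarith [Nat.le_ceil (x - s.re)]
  have hagree : ∀ j ∈ Finset.range (N + 1), ∀ᶠ z in 𝓝[≠] s, x - j < s.re → F N z = F j z := by
    intro j hj
    have hjN : (j : ℝ) ≤ N := by exact_mod_cast Finset.mem_range_succ_iff.1 hj
    refine eventually_imp_distrib_left.2 fun hjs => eventuallyEq_of_eqOn_halfPlane
      (fun z hz => hF N z (by linarith)) (hF j)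
      (fun z hz => (hFf N z hz).trans (hFf j z hz).symm) hjs
  have hclose : ∀ᶠ z : ℂ in 𝓝 s, |z.re - s.re| < 1 :=
    (isOpen_lt (by fun_prop) continuous_const).mem_nhds (by simp)
  refine (hF N s hsN).congr ?_
  filter_upwards [(Finset.eventually_all _).2 hagree,
    hclose.filter_mono nhdsWithin_le_nhds] with z hz hzs
  obtain ⟨hlower, hupper⟩ := abs_lt.1 hzs
  refine hz _ ?_ ?_
  · have : ⌈x - z.re⌉₊ ≤ ⌈x - s.re⌉₊ + 1 := by
      rw [Nat.ceil_le]
      push_cast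
      linarith [Nat.le_ceil (x - s.re)]
    rw [Finset.mem_range]
    lia
  · push_cast
    linarith [Nat.le_ceil (x - z.re)]

end Continuation

section SimpleResidue

/-- The function `f` has at most a simple pole at `z₀`, with residue `c` (zero if `f` extends
analytically to `z₀`). -/
def HasSimpleResidue (f : ℂ → ℂ) (z₀ c : ℂ) : Prop :=
  MeromorphicAt f z₀ ∧ Tendsto (fun z => (z - z₀) * f z) (𝓝[≠] z₀) (𝓝 c)

namespace HasSimpleResidue

variable {f g : ℂ → ℂ} {z₀ c : ℂ}

theorem congr (hf : HasSimpleResidue f z₀ c) (hfg : f =ᶠ[𝓝[≠] z₀] g) : HasSimpleResidue g z₀ c :=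
  ⟨hf.1.congr hfg, hf.2.congr' (hfg.mono fun z hz => by rw [hz])⟩

theorem add {d : ℂ} (hf : HasSimpleResidue f z₀ c) (hg : HasSimpleResidue g z₀ d) :
    HasSimpleResidue (fun z => f z + g z) z₀ (c + d) :=
  ⟨hf.1.fun_add hg.1, (hf.2.add hg.2).congr fun _ => (mul_add _ _ _).symm⟩

theorem sum {ι : Type*} {u : Finset ι} {F : ι → ℂ → ℂ} {C : ι → ℂ}
    (hF : ∀ i ∈ u, HasSimpleResidue (F i) z₀ (C i)) :
    HasSimpleResidue (fun z => ∑ i ∈ u, F i z) z₀ (∑ i ∈ u, C i) :=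
  ⟨MeromorphicAt.fun_sum fun i hi => (hF i hi).1,
    (tendsto_finsetSum u fun i hi => (hF i hi).2).congr fun _ => (Finset.mul_sum _ _ _).symm⟩

theorem analyticAt_mul (hf : HasSimpleResidue f z₀ c) (hg : AnalyticAt ℂ g z₀) :
    HasSimpleResidue (fun z => g z * f z) z₀ (g z₀ * c) :=
  ⟨hg.meromorphicAt.fun_mul hf.1,
    ((hg.continuousAt.tendsto.mono_left nhdsWithin_le_nhds).mul hf.2).congr fun _ =>
      mul_left_comm _ _ _⟩

theorem of_analyticAt (hf : AnalyticAt ℂ f z₀) : HasSimpleResidue f z₀ 0 := by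
  refine ⟨hf.meromorphicAt, ?_⟩
  have hlim : ContinuousAt (fun z => (z - z₀) * f z) z₀ :=
    (continuousAt_id.sub continuousAt_const).mul hf.continuousAt
  simpa using hlim.tendsto.mono_left nhdsWithin_le_nhds

theorem comp_add_const {w : ℂ} (hf : HasSimpleResidue f (z₀ + w) c) :
    HasSimpleResidue (fun z => f (z + w)) z₀ c := by
  have hshift : Tendsto (fun z => z + w) (𝓝[≠] z₀) (𝓝[≠] (z₀ + w)) :=
    ((hasDerivAt_id z₀).add_const w).tendsto_nhdsNE one_ne_zero
  exact ⟨hf.1.comp_analyticAt (g := fun z => z + w) (by fun_prop),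
    (hf.2.comp hshift).congr fun z => by simp⟩

theorem of_mul_ne_zero (h : HasSimpleResidue (fun z => g z * f z) z₀ c) (hg : AnalyticAt ℂ g z₀)
    (hg0 : g z₀ ≠ 0) : HasSimpleResidue f z₀ (c / g z₀) := by
  have hinv := h.analyticAt_mul (hg.inv hg0)
  rw [Pi.inv_apply, inv_mul_eq_div] at hinv
  refine hinv.congr ?_
  filter_upwards [(hg.continuousAt.eventually_ne hg0).filter_mono nhdsWithin_le_nhds] with z hz
  exact inv_mul_cancel_left₀ hz (f z)

theorem of_mul_simple_zero {u : ℂ → ℂ} {u' : ℂ} (hf : MeromorphicAt f z₀)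
    (hu : HasDerivAt u u' z₀) (hu0 : u z₀ = 0) (hu' : u' ≠ 0) (hg : ContinuousAt g z₀)
    (h : (fun z => u z * f z) =ᶠ[𝓝[≠] z₀] g) : HasSimpleResidue f z₀ (g z₀ / u') := by
  refine ⟨hf, ?_⟩
  have hslope : Tendsto (slope u z₀) (𝓝[≠] z₀) (𝓝 u') := hasDerivAt_iff_tendsto_slope.1 hu
  refine ((hg.tendsto.mono_left nhdsWithin_le_nhds).div hslope hu').congr' ?_
  filter_upwards [h, hslope.eventually_ne hu'] with z hz hz0
  have hu_eq : u z = (z - z₀) * slope u z₀ z := by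
    simpa [hu0] using (sub_smul_slope u z₀ z).symm
  rw [Pi.div_apply, div_eq_iff hz0, ← hz, hu_eq]
  ring

theorem isPole_iff (h : HasSimpleResidue f z₀ c) : IsPole f z₀ ↔ c ≠ 0 := by
  have hid : MeromorphicAt (fun z => z - z₀) z₀ := by fun_prop
  have hid_order : meromorphicOrderAt (fun z => z - z₀) z₀ = (1 : ℤ) :=
    (meromorphicOrderAt_eq_int_iff hid).2 ⟨fun _ => 1, analyticAt_const, one_ne_zero, by simp⟩
  have horder : meromorphicOrderAt (fun z => (z - z₀) * f z) z₀ =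
      (1 : ℤ) + meromorphicOrderAt f z₀ :=
    hid_order ▸ fun_meromorphicOrderAt_mul hid h.1
  have hneg : IsPole f z₀ ↔ ¬ 0 < meromorphicOrderAt (fun z => (z - z₀) * f z) z₀ := by
    rw [IsPole, and_iff_right h.1, horder]
    cases meromorphicOrderAt f z₀ with
    | top => simp
    | coe n =>
      norm_cast
      lia
  rw [hneg, ← tendsto_zero_iff_meromorphicOrderAt_pos (hid.fun_mul h.1), not_iff_not]
  exact ⟨fun h0 => tendsto_nhds_unique h.2 h0, fun hc => hc ▸ h.2⟩

theorem exists_analyticAt (h : HasSimpleResidue f z₀ c) :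
    ∃ g : ℂ → ℂ, AnalyticAt ℂ g z₀ ∧ g z₀ = c ∧ f =ᶠ[𝓝[≠] z₀] fun z => (z - z₀)⁻¹ * g z := by
  have hmul : MeromorphicAt (fun z => (z - z₀) * f z) z₀ :=
    MeromorphicAt.fun_mul (by fun_prop) h.1
  obtain ⟨g, hg, hfg⟩ := hmul.meromorphicOrderAt_nonneg_iff.1
    ((tendsto_nhds_iff_meromorphicOrderAt_nonneg hmul).1 ⟨c, h.2⟩)
  refine ⟨g, hg, tendsto_nhds_unique
    ((hg.continuousAt.tendsto.mono_left nhdsWithin_le_nhds).congr' hfg.symm) h.2, ?_⟩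
  filter_upwards [hfg, self_mem_nhdsWithin] with z hz hne
  rw [← hz, inv_mul_cancel_left₀ (sub_ne_zero.2 hne)]

theorem residue_eq (h : HasSimpleResidue f z₀ c) : residue f z₀ = c := by
  obtain ⟨g, hg, rfl, hfg⟩ := h.exists_analyticAt
  refine Tendsto.limUnder_eq (tendsto_const_nhds.congr' ?_)
  obtain ⟨ε, hε, hball⟩ := Metric.eventually_nhds_iff_ball.1
    (hg.eventually_analyticAt.and (eventually_nhdsWithin_iff.1 hfg))
  filter_upwards [Ioo_mem_nhdsGT hε] with r ⟨hr0, hrε⟩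
  have hcauchy : ∮ z in C(z₀, r), (z - z₀)⁻¹ • g z = (2 * Real.pi * Complex.I : ℂ) • g z₀ :=
    DifferentiableOn.circleIntegral_sub_inv_smul (c := z₀) (fun z hz =>
      (hball z (Metric.closedBall_subset_ball hrε hz)).1.differentiableAt.differentiableWithinAt)
      (Metric.mem_ball_self hr0)
  have hcongr : ∮ z in C(z₀, r), f z = ∮ z in C(z₀, r), (z - z₀)⁻¹ • g z :=
    circleIntegral.integral_congr hr0.le fun z hz =>
      (hball z (Metric.sphere_subset_ball hrε hz)).2 (Metric.ne_of_mem_sphere hz hr0.ne')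
  rw [hcongr, hcauchy, smul_eq_mul, inv_mul_cancel_left₀ Complex.two_pi_I_ne_zero]

end HasSimpleResidue

end SimpleResidue

section FunctionalEquation

variable {b : ℕ} {A : Finset ℕ}

/-- The factor `1 - N⁻¹ b ^ s` in front of `K s` in the functional equation, whose zeros are the
points `s_{0,k}`. -/
noncomputable def poleFactor (b : ℕ) (A : Finset ℕ) (s : ℂ) : ℂ :=
  1 - (A.card : ℂ)⁻¹ * (b : ℂ) ^ s

/-- The part of the functional equation which is analytic for `s₀ < Re s + n + 1`. -/
noncomputable def regularPart (b : ℕ) (A : Finset ℕ) (n : ℕ) (s : ℂ) : ℂ :=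
  -(A.card : ℂ)⁻¹ * ((b : ℂ) ^ s * digitSum A s + remainderSum b A (n + 1) s)

/-- The part of the functional equation of order `n` which involves the translates
`F (s + 1), …, F (s + n)` of the unknown function `F`. -/
noncomputable def shiftedPart (b : ℕ) (A : Finset ℕ) (n : ℕ) (F : ℂ → ℂ) (s : ℂ) : ℂ :=
  -(A.card : ℂ)⁻¹ * ∑ j ∈ Finset.Icc 1 n,
    Ring.choose (-s) j * ((b : ℂ) ^ j)⁻¹ * powerSum A j * F (s + j)

theorem differentiable_poleFactor (hb : b ≠ 0) (A : Finset ℕ) : Differentiable ℂ (poleFactor b A) :=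
  fun _ => ((differentiableAt_id.const_cpow (.inl (Nat.cast_ne_zero.2 hb))).const_mul _).const_sub 1

theorem analyticAt_regularPart (hb : 1 < b) (hA : ∀ a ∈ A, a < b) (hne : A.Nonempty) {n : ℕ}
    {s : ℂ} (hs : abscissa b A < s.re + (n + 1)) : AnalyticAt ℂ (regularPart b A n) s := by
  have hpow : AnalyticAt ℂ (fun s : ℂ => (b : ℂ) ^ s) s :=
    analyticAt_const.cpow analyticAt_id (Complex.natCast_mem_slitPlane.2 (by lia))
  refine analyticAt_const.mul (.fun_add (hpow.mul ((differentiable_digitSum A).analyticAt s)) ?_)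
  exact analyticAt_remainderSum hb hA hne (n + 1) (by exact_mod_cast hs)

theorem meromorphicAt_shiftedPart {n : ℕ} {F : ℂ → ℂ} {s : ℂ}
    (hF : ∀ j ∈ Finset.Icc 1 n, MeromorphicAt F (s + j)) :
    MeromorphicAt (shiftedPart b A n F) s := by
  refine (MeromorphicAt.const _ s).mul (MeromorphicAt.fun_sum fun j hj => ?_)
  have hchoose : MeromorphicAt (fun s : ℂ => Ring.choose (-s) j) s :=
    (((differentiable_choose j).comp differentiable_neg).analyticAt s).meromorphicAt
  exact ((hchoose.fun_mul (.const _ s)).fun_mul (.const _ s)).fun_mul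
    ((hF j hj).comp_analyticAt (g := fun z : ℂ => z + j) (by fun_prop))

theorem shiftedPart_congr {n : ℕ} {F G : ℂ → ℂ} {x : ℝ} {s : ℂ} (hs : x < s.re)
    (hFG : ∀ z : ℂ, x < z.re → F z = G z) : shiftedPart b A n F s = shiftedPart b A n G s := by
  refine congrArg _ (Finset.sum_congr rfl fun j _ => ?_)
  rw [hFG (s + j)]
  rw [Complex.add_re, Complex.natCast_re]
  exact hs.trans_le (le_add_of_nonneg_right j.cast_nonneg)

theorem sum_range_succ_eq_add_sum_Icc {M : Type*} [AddCommMonoid M] (u : ℕ → M) (n : ℕ) :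
    ∑ j ∈ Finset.range (n + 1), u j = u 0 + ∑ j ∈ Finset.Icc 1 n, u j := by
  rw [Finset.sum_range_eq_add_Ico u (Nat.zero_lt_succ n), Nat.succ_eq_add_one,
    Finset.Ico_add_one_right_eq_Icc]

theorem powerSum_zero (A : Finset ℕ) : powerSum A 0 = A.card := by simp [powerSum]

theorem poleFactor_mul_dirichletSum (hb : 1 < b) (hA : ∀ a ∈ A, a < b) (hne : A.Nonempty) (n : ℕ)
    {s : ℂ} (hs : abscissa b A < s.re) :
    poleFactor b A s * dirichletSum b A s =
      regularPart b A n s + shiftedPart b A n (dirichletSum b A) s := by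
  have hN : (A.card : ℂ) ≠ 0 := by exact_mod_cast hne.card_ne_zero
  have hpow : (b : ℂ) ^ s ≠ 0 := by
    rw [Complex.cpow_ne_zero_iff]
    exact .inl (Nat.cast_ne_zero.2 (by lia))
  have h := dirichletSum_eq hb hA hne (n + 1) hs
  rw [sum_range_succ_eq_add_sum_Icc, Complex.cpow_neg] at h
  simp only [Ring.choose_zero_right, pow_zero, powerSum_zero, Nat.cast_zero, add_zero,
    inv_one, mul_one, one_mul] at h
  rw [poleFactor, regularPart, shiftedPart]
  set S := ∑ j ∈ Finset.Icc 1 n,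
    Ring.choose (-s) j * ((b : ℂ) ^ j)⁻¹ * powerSum A j * dirichletSum b A (s + j)
  field_simp at h ⊢
  linear_combination -h

theorem poleFactor_ne_zero (hb : 1 < b) (hne : A.Nonempty) {s : ℂ} (hs : abscissa b A < s.re) :
    poleFactor b A s ≠ 0 := by
  have hN : (0 : ℝ) < A.card := by exact_mod_cast hne.card_pos
  have hlt : (A.card : ℝ) < b ^ s.re := by
    rw [← rpow_abscissa hb hne]
    exact Real.rpow_lt_rpow_of_exponent_lt (by exact_mod_cast hb) hs
  intro h0
  have heq : (A.card : ℂ) = (b : ℂ) ^ s := by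
    rw [poleFactor, sub_eq_zero, eq_inv_mul_iff_mul_eq₀ (by exact_mod_cast hN.ne'), mul_one] at h0
    exact h0
  have hnorm := congrArg norm heq
  rw [Complex.norm_natCast, Complex.norm_natCast_cpow_of_pos (zero_lt_one.trans hb)] at hnorm
  exact hlt.ne hnorm

theorem exists_meromorphic_halfPlane (hb : 1 < b) (hA : ∀ a ∈ A, a < b) (hne : A.Nonempty)
    (n : ℕ) : ∃ F : ℂ → ℂ, (∀ z : ℂ, abscissa b A - n < z.re → MeromorphicAt F z) ∧
      ∀ z : ℂ, abscissa b A < z.re → F z = dirichletSum b A z := by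
  induction n with
  | zero =>
    refine ⟨dirichletSum b A, fun z hz => ?_, fun _ _ => rfl⟩
    exact (analyticAt_dirichletSum hb hA hne (by simpa using hz)).meromorphicAt
  | succ n ih =>
    obtain ⟨F, hF, hFsum⟩ := ih
    refine ⟨fun z => (poleFactor b A z)⁻¹ * (regularPart b A n z + shiftedPart b A n F z),
      fun z hz => ?_, fun z hz => ?_⟩
    · push_cast at hz
      have hfactor : MeromorphicAt (poleFactor b A) z :=
        ((differentiable_poleFactor (by lia) A).analyticAt z).meromorphicAt
      refine hfactor.inv.mul
        ((analyticAt_regularPart hb hA hne (by linarith)).meromorphicAt.fun_add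
          (meromorphicAt_shiftedPart fun j hj => hF _ ?_))
      have hj1 : (1 : ℝ) ≤ j := by exact_mod_cast (Finset.mem_Icc.1 hj).1
      rw [Complex.add_re, Complex.natCast_re]
      linarith
    · rw [inv_mul_eq_iff_eq_mul₀ (poleFactor_ne_zero hb hne hz), shiftedPart_congr hz hFsum,
        poleFactor_mul_dirichletSum hb hA hne n hz]

theorem hasSum_term (hb : 1 < b) (hA : ∀ a ∈ A, a < b) (hne : A.Nonempty) {s : ℂ}
    (hs : abscissa b A < s.re) : HasSum (term b A s) (dirichletSum b A s) :=
  hasSum_subtype_iff_indicator.1 (summable_cpow hb hA hne hs).hasSum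

theorem exists_isMeromorphicContinuation (hb : 1 < b) (hA : ∀ a ∈ A, a < b) (hne : A.Nonempty) :
    ∃ K : ℂ → ℂ, IsMeromorphicContinuation b A K := by
  obtain ⟨K, hK, hKsum⟩ :=
    exists_meromorphic_of_halfPlanes (exists_meromorphic_halfPlane hb hA hne)
  exact ⟨K, hK, fun s hs => hKsum s hs ▸ hasSum_term hb hA hne hs⟩

namespace IsMeromorphicContinuation

variable {K : ℂ → ℂ}

theorem eq_dirichletSum (hK : IsMeromorphicContinuation b A K) {s : ℂ}
    (hs : abscissa b A < s.re) : K s = dirichletSum b A s :=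
  (hasSum_subtype_iff_indicator.2 (hK.2 s hs)).tsum_eq.symm

theorem functional_equation (hK : IsMeromorphicContinuation b A K) (hb : 1 < b)
    (hA : ∀ a ∈ A, a < b) (hne : A.Nonempty) (n : ℕ) {s : ℂ}
    (hs : abscissa b A < s.re + (n + 1)) :
    (fun z => poleFactor b A z * K z) =ᶠ[𝓝[≠] s]
      fun z => regularPart b A n z + shiftedPart b A n K z := by
  refine eventuallyEq_of_eqOn_halfPlane (x := abscissa b A - (n + 1)) (y := abscissa b A)
    (fun z _ => ((differentiable_poleFactor (by lia) A).analyticAt z).meromorphicAt.fun_mul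
      (hK.1 z))
    (fun z hz => (analyticAt_regularPart hb hA hne (by linarith)).meromorphicAt.fun_add
      (meromorphicAt_shiftedPart fun _ _ => hK.1 _))
    (fun z hz => ?_) (by linarith)
  rw [hK.eq_dirichletSum hz, poleFactor_mul_dirichletSum hb hA hne n hz,
    shiftedPart_congr hz fun w hw => hK.eq_dirichletSum hw]

end IsMeromorphicContinuation

end FunctionalEquation

section Residues

variable {b : ℕ} {A : Finset ℕ}

theorem candidatePole_eq_mk (b : ℕ) (A : Finset ℕ) (m : ℕ) (k : ℤ) :
    candidatePole b A m k = ⟨abscissa b A - m, k * (2 * Real.pi / Real.log b)⟩ := by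
  rw [candidatePole, Complex.mk_eq_add_mul_I]
  push_cast
  ring

theorem candidatePole_re (b : ℕ) (A : Finset ℕ) (m : ℕ) (k : ℤ) :
    (candidatePole b A m k).re = abscissa b A - m := by
  rw [candidatePole_eq_mk]

theorem candidatePole_im (b : ℕ) (A : Finset ℕ) (m : ℕ) (k : ℤ) :
    (candidatePole b A m k).im = k * (2 * Real.pi / Real.log b) := by
  rw [candidatePole_eq_mk]

theorem candidatePole_add (b : ℕ) (A : Finset ℕ) {m j : ℕ} (hj : j ≤ m) (k : ℤ) :
    candidatePole b A m k + j = candidatePole b A (m - j) k := by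
  rw [candidatePole, candidatePole, Nat.cast_sub hj]
  ring

theorem cpow_candidatePole (hb : 1 < b) (hne : A.Nonempty) (m : ℕ) (k : ℤ) :
    (b : ℂ) ^ candidatePole b A m k = A.card * ((b : ℂ) ^ m)⁻¹ := by
  have hb0 : (b : ℂ) ≠ 0 := by exact_mod_cast (zero_lt_one.trans hb).ne'
  have hlog : (Real.log b : ℂ) ≠ 0 := by
    exact_mod_cast (Real.log_pos (by exact_mod_cast hb)).ne'
  have habscissa : (b : ℂ) ^ (abscissa b A : ℂ) = A.card := by
    rw [← Complex.ofReal_natCast, ← Complex.ofReal_cpow (by positivity), rpow_abscissa hb hne,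
      Complex.ofReal_natCast]
  have hperiod : (b : ℂ) ^ ((k : ℂ) * (2 * Real.pi * Complex.I / Real.log b)) = 1 := by
    rw [Complex.cpow_def_of_ne_zero hb0, ← Complex.natCast_log, mul_left_comm,
      mul_div_cancel₀ _ hlog]
    exact Complex.exp_int_mul_two_pi_mul_I k
  rw [candidatePole, Complex.cpow_add _ _ hb0, Complex.cpow_sub _ _ hb0, Complex.cpow_natCast,
    habscissa, hperiod, mul_one, div_eq_mul_inv]

theorem poleFactor_candidatePole (hb : 1 < b) (hne : A.Nonempty) (m : ℕ) (k : ℤ) :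
    poleFactor b A (candidatePole b A m k) = 1 - ((b : ℂ) ^ m)⁻¹ := by
  rw [poleFactor, cpow_candidatePole hb hne,
    inv_mul_cancel_left₀ (by exact_mod_cast hne.card_ne_zero)]

theorem hasDerivAt_poleFactor (hb : 1 < b) (hne : A.Nonempty) (k : ℤ) :
    HasDerivAt (poleFactor b A) (-Real.log b) (candidatePole b A 0 k) := by
  have hb0 : (b : ℂ) ≠ 0 := by exact_mod_cast (zero_lt_one.trans hb).ne'
  have hN : (A.card : ℂ) ≠ 0 := by exact_mod_cast hne.card_ne_zero
  have h : HasDerivAt (poleFactor b A) (-((A.card : ℂ)⁻¹ *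
      ((b : ℂ) ^ candidatePole b A 0 k * Complex.log b * 1))) (candidatePole b A 0 k) :=
    (((hasDerivAt_id _).const_cpow (.inl hb0)).const_mul _).const_sub 1
  rwa [cpow_candidatePole hb hne, ← Complex.natCast_log, pow_zero, inv_one, mul_one, mul_one,
    inv_mul_cancel_left₀ hN] at h

theorem one_sub_inv_pow_ne_zero (hb : 1 < b) {m : ℕ} (hm : m ≠ 0) :
    (1 : ℂ) - ((b : ℂ) ^ m)⁻¹ ≠ 0 := by
  rw [sub_ne_zero, ne_comm, inv_ne_one]
  exact_mod_cast (Nat.one_lt_pow hm hb).ne'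

theorem shiftedPart_zero (F : ℂ → ℂ) (s : ℂ) : shiftedPart b A 0 F s = 0 := by
  simp [shiftedPart]

theorem hasSimpleResidue_shiftedPart {F : ℂ → ℂ} {n : ℕ} {s : ℂ} {c : ℕ → ℂ}
    (hF : ∀ j ∈ Finset.Icc 1 n, HasSimpleResidue F (s + j) (c j)) :
    HasSimpleResidue (shiftedPart b A n F) s (-(A.card : ℂ)⁻¹ * ∑ j ∈ Finset.Icc 1 n,
      Ring.choose (-s) j * ((b : ℂ) ^ j)⁻¹ * powerSum A j * c j) := by
  refine HasSimpleResidue.analyticAt_mul (.sum fun j hj => ?_) analyticAt_const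
  have hchoose : AnalyticAt ℂ (fun s : ℂ => Ring.choose (-s) j) s :=
    ((differentiable_choose j).comp differentiable_neg).analyticAt s
  exact (hF j hj).comp_add_const.analyticAt_mul
    (g := fun s => Ring.choose (-s) j * ((b : ℂ) ^ j)⁻¹ * powerSum A j)
    ((hchoose.mul analyticAt_const).mul analyticAt_const)

namespace IsMeromorphicContinuation

variable {K : ℂ → ℂ}

theorem hasSimpleResidue_zero (hK : IsMeromorphicContinuation b A K) (hb : 1 < b)
    (hA : ∀ a ∈ A, a < b) (hne : A.Nonempty) (k : ℤ) :
    HasSimpleResidue K (candidatePole b A 0 k)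
      (regularPart b A 0 (candidatePole b A 0 k) / -Real.log b) := by
  have hs : abscissa b A < (candidatePole b A 0 k).re + ((0 : ℕ) + 1) := by
    simp [candidatePole_re]
  refine .of_mul_simple_zero (hK.1 _) (hasDerivAt_poleFactor hb hne k) ?_ ?_
    (analyticAt_regularPart hb hA hne hs).continuousAt ?_
  · rw [poleFactor_candidatePole hb hne, pow_zero, inv_one, sub_self]
  · exact_mod_cast neg_ne_zero.2 (Real.log_pos (by exact_mod_cast hb)).ne'
  · simpa only [shiftedPart_zero, add_zero] using hK.functional_equation hb hA hne 0 hs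

theorem hasSimpleResidue_poleFactor_mul (hK : IsMeromorphicContinuation b A K) (hb : 1 < b)
    (hA : ∀ a ∈ A, a < b) (hne : A.Nonempty) {m : ℕ} {k : ℤ} {c : ℕ → ℂ}
    (hc : ∀ j ∈ Finset.Icc 1 m, HasSimpleResidue K (candidatePole b A (m - j) k) (c j)) :
    HasSimpleResidue (fun z => poleFactor b A z * K z) (candidatePole b A m k)
      (-(A.card : ℂ)⁻¹ * ∑ j ∈ Finset.Icc 1 m, Ring.choose (-candidatePole b A m k) j *
        ((b : ℂ) ^ j)⁻¹ * powerSum A j * c j) := by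
  have hs : abscissa b A < (candidatePole b A m k).re + (m + 1) := by
    rw [candidatePole_re]
    linarith
  have hshifted := hasSimpleResidue_shiftedPart (b := b) (A := A) (F := K) (n := m)
    (s := candidatePole b A m k) fun j hj => by
      rw [candidatePole_add b A (Finset.mem_Icc.1 hj).2]
      exact hc j hj
  have hregular := HasSimpleResidue.of_analyticAt (analyticAt_regularPart hb hA hne hs)
  simpa only [zero_add] using
    (hregular.add hshifted).congr (hK.functional_equation hb hA hne m hs).symm

theorem hasSimpleResidue (hK : IsMeromorphicContinuation b A K) (hb : 1 < b)
    (hA : ∀ a ∈ A, a < b) (hne : A.Nonempty) (m : ℕ) (k : ℤ) :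
    HasSimpleResidue K (candidatePole b A m k) (residue K (candidatePole b A m k)) := by
  induction m using Nat.strong_induction_on with
  | _ m ih =>
    obtain ⟨c, hc⟩ : ∃ c, HasSimpleResidue K (candidatePole b A m k) c := by
      rcases eq_or_ne m 0 with rfl | hm
      · exact ⟨_, hK.hasSimpleResidue_zero hb hA hne k⟩
      · have hmul := hK.hasSimpleResidue_poleFactor_mul hb hA hne fun j hj =>
          ih (m - j) (by have := Finset.mem_Icc.1 hj; lia)
        refine ⟨_, hmul.of_mul_ne_zero ((differentiable_poleFactor (by lia) A).analyticAt _) ?_⟩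
        rw [poleFactor_candidatePole hb hne]
        exact one_sub_inv_pow_ne_zero hb hm
    rwa [hc.residue_eq]

theorem residue_recurrence (hK : IsMeromorphicContinuation b A K) (hb : 1 < b)
    (hA : ∀ a ∈ A, a < b) (hne : A.Nonempty) (m : ℕ) (k : ℤ) :
    (1 - ((b : ℂ) ^ m)⁻¹) * residue K (candidatePole b A m k) =
      -(A.card : ℂ)⁻¹ * ∑ j ∈ Finset.Icc 1 m, Ring.choose (-candidatePole b A m k) j *
        ((b : ℂ) ^ j)⁻¹ * powerSum A j * residue K (candidatePole b A (m - j) k) := by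
  have hleft := (hK.hasSimpleResidue hb hA hne m k).analyticAt_mul
    ((differentiable_poleFactor (b := b) (by lia) A).analyticAt _)
  have hright := hK.hasSimpleResidue_poleFactor_mul hb hA hne fun j (_ : j ∈ Finset.Icc 1 m) =>
    hK.hasSimpleResidue hb hA hne (m - j) k
  rw [← hright.residue_eq, hleft.residue_eq, poleFactor_candidatePole hb hne]

end IsMeromorphicContinuation

theorem dirichletSum_ofReal (b : ℕ) (A : Finset ℕ) (σ : ℝ) :
    dirichletSum b A σ = (∑' n : AdmissibleNat b A, (n : ℝ) ^ (-σ) : ℝ) := by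
  rw [dirichletSum, Complex.ofReal_tsum]
  refine tsum_congr fun n => ?_
  rw [Complex.ofReal_cpow n.1.cast_nonneg, Complex.ofReal_natCast, Complex.ofReal_neg]

theorem regularPart_ofReal_le (hb : 1 < b) (hA : ∀ a ∈ A, a < b) (hA1 : ∃ a ∈ A, a ≠ 0) {σ : ℝ}
    (hσ : abscissa b A < σ) : (regularPart b A 0 σ).re ≤ -(A.card : ℝ)⁻¹ := by
  have hne : A.Nonempty := hA1.imp fun _ h => h.1
  have hb0 : (0 : ℝ) < b := by positivity
  have hN : (0 : ℝ) < A.card := by exact_mod_cast hne.card_pos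
  have hfactor : poleFactor b A σ = (1 - (A.card : ℝ)⁻¹ * (b : ℝ) ^ σ : ℝ) := by
    rw [poleFactor]
    push_cast
    rw [Complex.ofReal_cpow hb0.le, Complex.ofReal_natCast]
  have hregular : regularPart b A 0 σ = poleFactor b A σ * dirichletSum b A σ := by
    rw [poleFactor_mul_dirichletSum hb hA hne 0 (s := σ) hσ, shiftedPart_zero, add_zero]
  rw [hregular, hfactor, dirichletSum_ofReal, ← Complex.ofReal_mul, Complex.ofReal_re]
  have h := rpow_neg_le_mul_tsum hb hA hA1 hσ
  have hpow : (0 : ℝ) < (b : ℝ) ^ σ := by positivity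
  rw [Real.rpow_neg hb0.le] at h
  field_simp at h ⊢
  linarith

theorem IsMeromorphicContinuation.residue_zero_zero_ne_zero {K : ℂ → ℂ}
    (hK : IsMeromorphicContinuation b A K) (hb : 1 < b) (hA : ∀ a ∈ A, a < b)
    (hA1 : ∃ a ∈ A, a ≠ 0) : residue K (candidatePole b A 0 0) ≠ 0 := by
  have hne : A.Nonempty := hA1.imp fun _ h => h.1
  have hN : (0 : ℝ) < (A.card : ℝ)⁻¹ := inv_pos.2 (by exact_mod_cast hne.card_pos)
  have hlog : (-Real.log b : ℂ) ≠ 0 := by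
    exact_mod_cast neg_ne_zero.2 (Real.log_pos (by exact_mod_cast hb)).ne'
  have hs : candidatePole b A 0 0 = (abscissa b A : ℂ) := by simp [candidatePole]
  rw [(hK.hasSimpleResidue_zero hb hA hne 0).residue_eq, hs]
  have hcont : ContinuousAt (fun σ : ℝ => (regularPart b A 0 σ).re) (abscissa b A) :=
    Complex.continuous_re.continuousAt.comp
      ((analyticAt_regularPart hb hA hne (by simp)).continuousAt.comp
        Complex.continuous_ofReal.continuousAt)
  have hle : (regularPart b A 0 (abscissa b A)).re ≤ -(A.card : ℝ)⁻¹ :=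
    le_of_tendsto (hcont.tendsto.mono_left (nhdsWithin_le_nhds (s := Set.Ioi _)))
      (eventually_nhdsWithin_of_forall fun σ hσ => regularPart_ofReal_le hb hA hA1 hσ)
  refine div_ne_zero (fun h0 => ?_) hlog
  rw [h0, Complex.zero_re] at hle
  linarith

end Residues

section Recurrence

variable {b : ℕ} {A : Finset ℕ} {v w : ℕ → ℂ}

/-- The linear recurrence (1), for a sequence `v` in place of the modified residues. -/
def SatisfiesRecurrence (b : ℕ) (A : Finset ℕ) (v : ℕ → ℂ) : Prop :=
  ∀ m : ℕ, (1 - ((b : ℂ) ^ m)⁻¹) * v m = -(A.card : ℂ)⁻¹ * ∑ j ∈ Finset.Icc 1 m,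
    (m.choose j : ℂ) * ((b : ℂ) ^ j)⁻¹ * powerSum A j * v (m - j)

theorem SatisfiesRecurrence.mul_eq_mul (hb : 1 < b) (hv : SatisfiesRecurrence b A v)
    (hw : SatisfiesRecurrence b A w) (m : ℕ) : v m * w 0 = v 0 * w m := by
  induction m using Nat.strong_induction_on with
  | _ m ih =>
    rcases eq_or_ne m 0 with rfl | hm
    · rfl
    · refine mul_left_cancel₀ (one_sub_inv_pow_ne_zero hb hm) ?_
      rw [← mul_assoc, hv m, mul_left_comm, hw m, mul_left_comm, mul_assoc, Finset.sum_mul,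
        Finset.mul_sum _ _ (v 0)]
      refine congrArg _ (Finset.sum_congr rfl fun j hj => ?_)
      have hprev := ih (m - j) (by have := Finset.mem_Icc.1 hj; lia)
      linear_combination (m.choose j : ℂ) * ((b : ℂ) ^ j)⁻¹ * powerSum A j * hprev

theorem satisfiesRecurrence_normalizedSolution (hb : 1 < b) (A : Finset ℕ) :
    SatisfiesRecurrence b A (normalizedSolution b A) := by
  rintro (_ | m)
  · simp
  · rw [normalizedSolution, mul_div_cancel₀ _ (one_sub_inv_pow_ne_zero hb m.succ_ne_zero),
      Fin.sum_univ_eq_sum_range fun i => ((m + 1).choose (m + 1 - i) : ℂ) *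
        ((b : ℂ) ^ (m + 1 - i))⁻¹ * powerSum A (m + 1 - i) * normalizedSolution b A i]
    refine congrArg _ (Finset.sum_nbij' (m + 1 - ·) (m + 1 - ·) ?_ ?_ ?_ ?_ fun i hi => ?_)
    any_goals
      simp only [Finset.mem_range, Finset.mem_Icc]
      lia
    rw [Nat.sub_sub_self (Finset.mem_range.1 hi).le]

theorem satisfiesRecurrence_singleton (hb : 1 < b) (f : ℕ) :
    SatisfiesRecurrence b {f} fun m => (-(f : ℂ) / (b - 1)) ^ m := by
  intro m
  have hb0 : (b : ℂ) ≠ 0 := by exact_mod_cast (zero_lt_one.trans hb).ne'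
  have hb1 : (b : ℂ) - 1 ≠ 0 := sub_ne_zero.2 (by exact_mod_cast hb.ne')
  have hterm (j : ℕ) : (m.choose j : ℂ) * ((b : ℂ) ^ j)⁻¹ * powerSum {f} j *
      (-(f : ℂ) / (b - 1)) ^ (m - j) =
      (f / b : ℂ) ^ j * (-(f : ℂ) / (b - 1)) ^ (m - j) * m.choose j := by
    rw [powerSum, Finset.sum_singleton, div_pow]
    ring
  have hfixed : (f / b : ℂ) + -(f : ℂ) / (b - 1) = (-(f : ℂ) / (b - 1)) * (b : ℂ)⁻¹ := by
    field_simp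
    ring
  have hbinom := add_pow (f / b : ℂ) (-(f : ℂ) / (b - 1)) m
  rw [hfixed, mul_pow, inv_pow, sum_range_succ_eq_add_sum_Icc, pow_zero, one_mul, Nat.sub_zero,
    Nat.choose_zero_right, Nat.cast_one, mul_one] at hbinom
  rw [Finset.sum_congr rfl fun j _ => hterm j, Finset.card_singleton, Nat.cast_one, inv_one]
  linear_combination -hbinom

end Recurrence

section ModifiedResidue

variable {b : ℕ} {A : Finset ℕ} {K : ℂ → ℂ}

/-- The ratio `-(-σ)_{m+1} / m!` between the residue `λ_{m,k}` and the modified residue `μ_{m,k}`,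
where `σ = s_{0,k}`. -/
noncomputable def residueFactor (σ : ℂ) (m : ℕ) : ℂ :=
  -((ascPochhammer ℂ (m + 1)).eval (-σ)) / (m.factorial : ℂ)

theorem residueFactor_eq (σ : ℂ) (m : ℕ) : residueFactor σ m = σ * Ring.choose (m - σ) m := by
  have hmulti := Ring.factorial_nsmul_multichoose_eq_ascPochhammer (1 - σ) m
  rw [Ring.multichoose_eq, Polynomial.ascPochhammer_smeval_eq_eval, nsmul_eq_mul,
    show 1 - σ + m - 1 = m - σ by ring] at hmulti
  rw [residueFactor, div_eq_iff (by exact_mod_cast m.factorial_ne_zero), ascPochhammer_succ_left,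
    Polynomial.eval_mul, Polynomial.eval_X, Polynomial.eval_comp, Polynomial.eval_add,
    Polynomial.eval_X, Polynomial.eval_one, neg_add_eq_sub, ← hmulti]
  ring

theorem choose_mul_residueFactor (σ : ℂ) {j m : ℕ} (hj : j ≤ m) :
    Ring.choose (m - σ) j * residueFactor σ (m - j) = residueFactor σ m * m.choose j := by
  have h := Ring.choose_smul_choose (m - σ) hj
  rw [nsmul_eq_mul, sub_right_comm, ← Nat.cast_sub hj] at h
  rw [residueFactor_eq, residueFactor_eq]
  linear_combination -σ * h

theorem residueFactor_ne_zero {σ : ℂ} (hσ : ∀ i : ℕ, σ ≠ i) (m : ℕ) : residueFactor σ m ≠ 0 := by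
  refine div_ne_zero (neg_ne_zero.2 fun h0 => ?_) (by exact_mod_cast m.factorial_ne_zero)
  obtain ⟨i, -, hi⟩ := (ascPochhammer_eval_eq_zero_iff _ _).1 h0
  exact hσ i (by rw [hi, neg_neg])

theorem im_ne_zero_of_ne_zero (hb : 1 < b) (A : Finset ℕ) (m : ℕ) {k : ℤ} (hk : k ≠ 0) :
    (candidatePole b A m k).im ≠ 0 := by
  have hlog : 0 < Real.log b := Real.log_pos (by exact_mod_cast hb)
  rw [candidatePole_im]
  exact mul_ne_zero (by exact_mod_cast hk) (by positivity)

theorem card_eq_pow_of_candidatePole_eq (hb : 1 < b) (hne : A.Nonempty) {k : ℤ} {i : ℕ}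
    (h : candidatePole b A 0 k = i) : A.card = b ^ i := by
  have hre := congrArg Complex.re h
  rw [candidatePole_re, Complex.natCast_re, Nat.cast_zero, sub_zero] at hre
  have hcard := rpow_abscissa hb hne
  rw [hre, Real.rpow_natCast] at hcard
  exact_mod_cast hcard.symm

theorem card_le_of_forall_lt (hA : ∀ a ∈ A, a < b) : A.card ≤ b := by
  simpa using Finset.card_le_card (t := Finset.range b) fun a ha => Finset.mem_range.2 (hA a ha)

theorem candidatePole_ne_natCast (hb : 1 < b) (hA : ∀ a ∈ A, a < b) (hne : A.Nonempty) {k : ℤ}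
    (h1 : ¬(k = 0 ∧ A.card = 1)) (h2 : ¬(k = 0 ∧ A.card = b)) (i : ℕ) :
    candidatePole b A 0 k ≠ i := by
  intro h
  have hk : k = 0 := by
    by_contra hk
    exact im_ne_zero_of_ne_zero hb A 0 hk (by rw [h, Complex.natCast_im])
  have hcard := card_eq_pow_of_candidatePole_eq hb hne h
  rcases i with _ | _ | i
  · exact h1 ⟨hk, by rw [hcard, pow_zero]⟩
  · exact h2 ⟨hk, by rw [hcard, zero_add, pow_one]⟩
  · have hlt : b ^ 1 < b ^ (i + 1 + 1) := Nat.pow_lt_pow_right hb (by lia)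
    have hle := card_le_of_forall_lt hA
    lia

theorem modifiedResidue_eq_div {k : ℤ} (h1 : ¬(k = 0 ∧ A.card = 1)) (h2 : ¬(k = 0 ∧ A.card = b))
    (m : ℕ) : modifiedResidue b A K m k =
      residue K (candidatePole b A m k) / residueFactor (candidatePole b A 0 k) m := by
  rw [modifiedResidue, if_neg h1, if_neg h2, residueFactor]

theorem modifiedResidue_singleton (f m : ℕ) :
    modifiedResidue b {f} K m 0 = (-(f : ℂ) / (b - 1)) ^ m := by
  rw [modifiedResidue, if_pos ⟨rfl, Finset.card_singleton f⟩, Finset.sum_singleton]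

theorem modifiedResidue_of_card_eq (hb : 1 < b) (h : A.card = b) (m : ℕ) :
    modifiedResidue b A K m 0 = normalizedSolution b A m := by
  rw [modifiedResidue, if_neg (by lia), if_pos ⟨rfl, h⟩]

namespace IsMeromorphicContinuation

theorem isPole_iff_residue_ne_zero (hK : IsMeromorphicContinuation b A K) (hb : 1 < b)
    (hA : ∀ a ∈ A, a < b) (hne : A.Nonempty) (m : ℕ) (k : ℤ) :
    IsPole K (candidatePole b A m k) ↔ residue K (candidatePole b A m k) ≠ 0 :=
  (hK.hasSimpleResidue hb hA hne m k).isPole_iff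

theorem satisfiesRecurrence_of_residue_eq_mul (hK : IsMeromorphicContinuation b A K) (hb : 1 < b)
    (hA : ∀ a ∈ A, a < b) (hne : A.Nonempty) {k : ℤ} {u v : ℕ → ℂ} (hu : ∀ m, u m ≠ 0)
    (hchoose : ∀ j m, j ≤ m →
      Ring.choose (-candidatePole b A m k) j * u (m - j) = u m * m.choose j)
    (huv : ∀ m, residue K (candidatePole b A m k) = u m * v m) : SatisfiesRecurrence b A v := by
  refine fun m => mul_left_cancel₀ (hu m) ?_
  rw [mul_left_comm, ← huv, hK.residue_recurrence hb hA hne, mul_left_comm,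
    Finset.mul_sum _ _ (u m)]
  refine congrArg _ (Finset.sum_congr rfl fun j hj => ?_)
  rw [huv]
  linear_combination
    ((b : ℂ) ^ j)⁻¹ * powerSum A j * v (m - j) * hchoose j m (Finset.mem_Icc.1 hj).2

theorem satisfiesRecurrence_modifiedResidue (hK : IsMeromorphicContinuation b A K) (hb : 1 < b)
    (hA : ∀ a ∈ A, a < b) (hne : A.Nonempty) (k : ℤ) :
    SatisfiesRecurrence b A fun m => modifiedResidue b A K m k := by
  by_cases h1 : k = 0 ∧ A.card = 1
  · obtain ⟨rfl, hcard⟩ := h1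
    obtain ⟨f, rfl⟩ := Finset.card_eq_one.1 hcard
    simpa only [modifiedResidue_singleton] using satisfiesRecurrence_singleton hb f
  by_cases h2 : k = 0 ∧ A.card = b
  · obtain ⟨rfl, hcard⟩ := h2
    simpa only [modifiedResidue_of_card_eq hb hcard] using
      satisfiesRecurrence_normalizedSolution hb A
  have hfactor := residueFactor_ne_zero (candidatePole_ne_natCast hb hA hne h1 h2)
  refine hK.satisfiesRecurrence_of_residue_eq_mul (k := k) hb hA hne hfactor
    (fun j m hj => ?_) fun m => ?_
  · have hneg : -candidatePole b A m k = m - candidatePole b A 0 k := by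
      rw [← Nat.sub_self m, ← candidatePole_add b A le_rfl]
      ring
    rw [hneg, choose_mul_residueFactor _ hj]
  · rw [modifiedResidue_eq_div h1 h2, mul_div_cancel₀ _ (hfactor m)]

theorem modifiedResidue_zero_zero_ne_zero (hK : IsMeromorphicContinuation b A K) (hb : 1 < b)
    (hA : ∀ a ∈ A, a < b) (hA1 : ∃ a ∈ A, a ≠ 0) : modifiedResidue b A K 0 0 ≠ 0 := by
  have hne : A.Nonempty := hA1.imp fun _ h => h.1
  by_cases h1 : A.card = 1
  · obtain ⟨f, rfl⟩ := Finset.card_eq_one.1 h1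
    rw [modifiedResidue_singleton, pow_zero]
    exact one_ne_zero
  by_cases h2 : A.card = b
  · rw [modifiedResidue_of_card_eq hb h2, normalizedSolution]
    exact one_ne_zero
  replace h1 : ¬((0 : ℤ) = 0 ∧ A.card = 1) := fun h => h1 h.2
  replace h2 : ¬((0 : ℤ) = 0 ∧ A.card = b) := fun h => h2 h.2
  rw [modifiedResidue_eq_div h1 h2]
  exact div_ne_zero (hK.residue_zero_zero_ne_zero hb hA hA1)
    (residueFactor_ne_zero (candidatePole_ne_natCast hb hA hne h1 h2) 0)

theorem modifiedResidue_eq (hK : IsMeromorphicContinuation b A K) (hb : 1 < b)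
    (hA : ∀ a ∈ A, a < b) (hA1 : ∃ a ∈ A, a ≠ 0) (m : ℕ) (k : ℤ) :
    modifiedResidue b A K m k =
      modifiedResidue b A K 0 k / modifiedResidue b A K 0 0 * modifiedResidue b A K m 0 := by
  have hne : A.Nonempty := hA1.imp fun _ h => h.1
  rw [div_mul_eq_mul_div, eq_div_iff (hK.modifiedResidue_zero_zero_ne_zero hb hA hA1)]
  exact (hK.satisfiesRecurrence_modifiedResidue hb hA hne k).mul_eq_mul hb
    (hK.satisfiesRecurrence_modifiedResidue hb hA hne 0) m

end IsMeromorphicContinuation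

end ModifiedResidue

section Poles

variable {b : ℕ} {A : Finset ℕ} {K : ℂ → ℂ}

theorem admissible_range_iff (hb : 1 < b) {n : ℕ} : Admissible b (Finset.range b) n ↔ 0 < n :=
  and_iff_left fun _ hd => Finset.mem_range.2 (Nat.digits_lt_base hb hd)

theorem abscissa_range (hb : 1 < b) : abscissa b (Finset.range b) = 1 := by
  rw [abscissa, Finset.card_range, Real.logb_self_eq_one (by exact_mod_cast hb)]

namespace IsMeromorphicContinuation

theorem eq_riemannZeta (hK : IsMeromorphicContinuation b (Finset.range b) K) (hb : 1 < b) {z : ℂ}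
    (hz : 1 < z.re) : K z = riemannZeta z := by
  have hsum := hK.2 z (by rwa [abscissa_range hb])
  rw [← hsum.tsum_eq, zeta_eq_tsum_one_div_nat_cpow hz]
  refine tsum_congr fun n => ?_
  rw [term]
  rcases eq_or_ne n 0 with rfl | hn
  · have hz0 : z ≠ 0 := by
      rintro rfl
      exact zero_lt_one.not_gt hz
    rw [Set.indicator_of_notMem fun h => (lt_irrefl 0 h.1), Nat.cast_zero, Complex.zero_cpow hz0,
      div_zero]
  · have hmem : n ∈ {n | Admissible b (Finset.range b) n} :=
      (admissible_range_iff hb).2 (Nat.pos_of_ne_zero hn)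
    rw [Set.indicator_of_mem hmem, Complex.cpow_neg, one_div]

theorem eventuallyEq_riemannZeta (hK : IsMeromorphicContinuation b (Finset.range b) K)
    (hb : 1 < b) {z : ℂ} (hz : z ≠ 1) : K =ᶠ[𝓝[≠] z] riemannZeta := by
  have hnear : K =ᶠ[𝓝 2] riemannZeta := by
    filter_upwards [(isOpen_lt continuous_const Complex.continuous_re).mem_nhds
      (show (1 : ℝ) < (2 : ℂ).re by norm_num)] with w hw using hK.eq_riemannZeta hb hw
  exact eventuallyEq_of_meromorphicOn (fun w _ => hK.1 w)
    analyticOn_riemannZeta.meromorphicOn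
    (isConnected_compl_singleton_of_one_lt_rank (by simp) 1).isPreconnected
    (show (2 : ℂ) ∈ ({1}ᶜ : Set ℂ) by norm_num) hz (hnear.filter_mono nhdsWithin_le_nhds)

theorem not_isPole_of_card_eq (hK : IsMeromorphicContinuation b A K) (hb : 1 < b)
    (hA : ∀ a ∈ A, a < b) (hcard : A.card = b) {k : ℤ} (hk : k ≠ 0) :
    ¬IsPole K (candidatePole b A 0 k) := by
  obtain rfl : A = Finset.range b := Finset.eq_of_subset_of_card_le
    (fun a ha => Finset.mem_range.2 (hA a ha)) (by rw [Finset.card_range, hcard])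
  have hone : candidatePole b (Finset.range b) 0 k ≠ 1 := fun h =>
    im_ne_zero_of_ne_zero hb _ 0 hk (by rw [h, Complex.one_im])
  have hζ : AnalyticAt ℂ riemannZeta (candidatePole b (Finset.range b) 0 k) :=
    analyticOn_riemannZeta _ hone
  rw [((HasSimpleResidue.of_analyticAt hζ).congr
    (hK.eventuallyEq_riemannZeta hb hone).symm).isPole_iff]
  exact not_not.2 rfl

theorem residue_singleton {f : ℕ} (hK : IsMeromorphicContinuation b {f} K) (hb : 1 < b)
    (hf : f < b) (m : ℕ) : residue K (candidatePole b {f} m 0) =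
      residue K (candidatePole b {f} 0 0) * modifiedResidue b {f} K m 0 := by
  have hA : ∀ a ∈ ({f} : Finset ℕ), a < b := by simpa using hf
  have hne := Finset.singleton_nonempty f
  have hpole (m : ℕ) : -candidatePole b {f} m 0 = m := by simp [candidatePole, abscissa]
  have hrec : SatisfiesRecurrence b {f} fun m => residue K (candidatePole b {f} m 0) :=
    hK.satisfiesRecurrence_of_residue_eq_mul hb hA hne (fun _ => one_ne_zero)
      (fun j m _ => by rw [hpole, Ring.choose_natCast, one_mul, mul_one])
      fun m => (one_mul _).symm
  have hprop := hrec.mul_eq_mul hb (hK.satisfiesRecurrence_modifiedResidue hb hA hne 0) m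
  rwa [modifiedResidue_singleton f 0, pow_zero, mul_one] at hprop

theorem isPole_iff_modifiedResidue_ne_zero (hK : IsMeromorphicContinuation b A K) (hb : 1 < b)
    (hA : ∀ a ∈ A, a < b) (hA1 : ∃ a ∈ A, a ≠ 0) {k : ℤ} (h2 : ¬(k = 0 ∧ A.card = b)) (m : ℕ) :
    IsPole K (candidatePole b A m k) ↔ modifiedResidue b A K m k ≠ 0 := by
  have hne : A.Nonempty := hA1.imp fun _ h => h.1
  rw [hK.isPole_iff_residue_ne_zero hb hA hne]
  by_cases h1 : k = 0 ∧ A.card = 1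
  · obtain ⟨rfl, hcard⟩ := h1
    have h00 := hK.residue_zero_zero_ne_zero hb hA hA1
    obtain ⟨f, rfl⟩ := Finset.card_eq_one.1 hcard
    rw [hK.residue_singleton hb (hA f (Finset.mem_singleton_self f)), mul_ne_zero_iff,
      and_iff_right h00]
  · rw [modifiedResidue_eq_div h1 h2, Ne, Ne, div_eq_zero_iff,
      or_iff_left (residueFactor_ne_zero (candidatePole_ne_natCast hb hA hne h1 h2) m)]

theorem isPole_iff_isPole_and_isPole (hK : IsMeromorphicContinuation b A K) (hb : 1 < b)
    (hA : ∀ a ∈ A, a < b) (hA1 : ∃ a ∈ A, a ≠ 0) (m : ℕ) (k : ℤ) :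
    IsPole K (candidatePole b A m k) ↔
      IsPole K (candidatePole b A m 0) ∧ IsPole K (candidatePole b A 0 k) := by
  rcases eq_or_ne k 0 with rfl | hk
  · have hne : A.Nonempty := hA1.imp fun _ h => h.1
    exact (and_iff_left ((hK.isPole_iff_residue_ne_zero hb hA hne 0 0).2
      (hK.residue_zero_zero_ne_zero hb hA hA1))).symm
  have hpole := hK.isPole_iff_modifiedResidue_ne_zero hb hA hA1 (k := k) (fun h => hk h.1)
  have hsplit : IsPole K (candidatePole b A m k) ↔
      modifiedResidue b A K m 0 ≠ 0 ∧ IsPole K (candidatePole b A 0 k) := by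
    rw [hpole, hpole, hK.modifiedResidue_eq hb hA hA1 m k, mul_ne_zero_iff, div_ne_zero_iff,
      and_iff_left (hK.modifiedResidue_zero_zero_ne_zero hb hA hA1), and_comm]
  rw [hsplit, and_congr_left_iff]
  intro h0k
  have hcard : A.card ≠ b := fun h => hK.not_isPole_of_card_eq hb hA h hk h0k
  exact (hK.isPole_iff_modifiedResidue_ne_zero hb hA hA1 (fun h => hcard h.2) m).symm

end IsMeromorphicContinuation

end Poles

end RestrictedDirichlet

theorem mainTheorem8 (b : ℕ) (hb : 1 < b) (A : Finset ℕ) (hA : ∀ a ∈ A, a < b)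
    (hA1 : ∃ a ∈ A, a ≠ 0) :
    (∃ K : ℂ → ℂ, RestrictedDirichlet.IsMeromorphicContinuation b A K) ∧
    ∀ K : ℂ → ℂ, RestrictedDirichlet.IsMeromorphicContinuation b A K →
      (∀ (m : ℕ) (k : ℤ),
        (1 - ((b : ℂ) ^ m)⁻¹) * RestrictedDirichlet.modifiedResidue b A K m k =
          -((A.card : ℂ)⁻¹) * ∑ j ∈ Finset.Icc 1 m,
            (m.choose j : ℂ) * ((b : ℂ) ^ j)⁻¹ * RestrictedDirichlet.powerSum A j *
              RestrictedDirichlet.modifiedResidue b A K (m - j) k) ∧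
      RestrictedDirichlet.modifiedResidue b A K 0 0 ≠ 0 ∧
      (∀ (m : ℕ) (k : ℤ),
        RestrictedDirichlet.modifiedResidue b A K m k =
          RestrictedDirichlet.modifiedResidue b A K 0 k /
            RestrictedDirichlet.modifiedResidue b A K 0 0 *
              RestrictedDirichlet.modifiedResidue b A K m 0) ∧
      (∀ (m : ℕ) (k : ℤ),
        RestrictedDirichlet.IsPole K (RestrictedDirichlet.candidatePole b A m k) ↔
          RestrictedDirichlet.IsPole K (RestrictedDirichlet.candidatePole b A m 0) ∧
          RestrictedDirichlet.IsPole K (RestrictedDirichlet.candidatePole b A 0 k)) := by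
  have hne : A.Nonempty := hA1.imp fun _ h => h.1
  refine ⟨RestrictedDirichlet.exists_isMeromorphicContinuation hb hA hne,
    fun K hK => ⟨?_, ?_, ?_, ?_⟩⟩
  · exact fun m k => hK.satisfiesRecurrence_modifiedResidue hb hA hne k m
  · exact hK.modifiedResidue_zero_zero_ne_zero hb hA hA1
  · exact hK.modifiedResidue_eq hb hA hA1
  · exact hK.isPole_iff_isPole_and_isPole hb hA hA1
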